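/- Let $m>0$. On $\mathbb{R}^4\cong\mathbb{C}^2$, with coordinates $z_1=x_1+ix_2$, $z_2=x_3+ix_4$, standard complex structure $I_1$ and euclidean norm $r=(|z_1|^2+|z_2|^2)^{1/2}$, let $u,v\colon\mathbb{C}^2\to\mathbb{R}$ be the functions defined implicitly by $$|z_1|=e^{m(u^2-v^2)}u,\qquad |z_2|=e^{m(v^2-u^2)}v,$$ and set $y_1=\frac12(u^2-v^2)$, $y_2+iy_3=-iz_1z_2$, $R=\frac12(u^2+v^2)$ and, away from the origin, $V=\frac{1+4mR}{2R}$ and $\eta=I_1(V\,dy_1)$, where $I_1$ acts on $1$-forms by $I_1\beta=-\beta(I_1\,\cdot)$. Let $\mathbf{f}$ be the Taub-NUT metric $$\mathbf{f}=V(dy_1^2+dy_2^2+dy_3^2)+V^{-1}\eta^2$$ on $\mathbb{R}^4\setminus\{0\}$, extended to $\mathbb{R}^4$ by the euclidean metric at $0$. Let $a\in\mathbb{R}$ and $\kappa>0$, let $\beth\colon\mathbb{R}^4\to\mathbb{R}^4$ be the map $\beth(z_1,z_2)=\bigl(1+\frac{a}{\kappa+r^4}\bigr)(z_1,z_2)$,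 and put $\mathbf{f}^\flat=\beth^*\mathbf{f}$. Then for $\ell=0,1,2$, $$\bigl|(\nabla^{\mathbf{f}})^\ell(\mathbf{f}^\flat-\mathbf{f})\bigr|_{\mathbf{f}}=O(R^{-1})\quad\text{on }\mathbb{R}^4,$$ where $\nabla^{\mathbf{f}}$ is the Levi-Civita connection of $\mathbf{f}$ and $|\cdot|_{\mathbf{f}}$ the pointwise norm that $\mathbf{f}$ induces on tensors. Moreover $\beth^*R=R+O(R^{-1})$. Here $O(R^{-1})$ means bounded in absolute value on $\mathbb{R}^4\setminus\{0\}$ by $C R^{-1}$, with a constant $C$ depending only on $m$, $a$ and $\kappa$. -/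

import Mathlib

noncomputable section

namespace TaubNUT

/-! ### Tensor calculus on `ℝ⁴` in the standard coordinates -/

/-- The space `ℝ⁴`, with its euclidean norm `r = ‖x‖`. -/
abbrev E4 : Type := EuclideanSpace ℝ (Fin 4)

/-- The `i`-th vector of the standard basis. -/
def basisVec (i : Fin 4) : E4 := EuclideanSpace.single i 1

/-- The partial derivative `∂ᵢ F` of a real function. -/
def pderiv (i : Fin 4) (F : E4 → ℝ) (x : E4) : ℝ := fderiv ℝ F x (basisVec i)

/-- A field of bilinear forms, given by its matrix of components `g x i j = g(∂ᵢ, ∂ⱼ)` at `x`. -/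
abbrev BilinField : Type := E4 → Matrix (Fin 4) (Fin 4) ℝ

/-- A covariant tensor field of rank `k`, given by its components
`T x I = T(∂_{I 0}, …, ∂_{I (k-1)})` at `x`. -/
abbrev TensorField (k : ℕ) : Type := E4 → (Fin k → Fin 4) → ℝ

/-- A field of bilinear forms as a covariant tensor field of rank two. -/
def BilinField.toTensor (h : BilinField) : TensorField 2 := fun x I => h x (I 0) (I 1)

/-- The pull-back `F^* g`, whose components are `g(F x)(dF ∂ᵢ, dF ∂ⱼ)`. -/
def pullback (F : E4 → E4) (g : BilinField) : BilinField := fun x =>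
  Matrix.of fun i j => ∑ k : Fin 4, ∑ l : Fin 4,
    g (F x) k l * (fderiv ℝ F x (basisVec i)) k * (fderiv ℝ F x (basisVec j)) l

/-- The Christoffel symbol `Γᵏᵢⱼ = ½ gᵏˡ (∂ᵢ gⱼₗ + ∂ⱼ gᵢₗ - ∂ₗ gᵢⱼ)` of the Levi-Civita
connection of `g`. -/
def christoffel (g : BilinField) (x : E4) (k i j : Fin 4) : ℝ :=
  (1 / 2) * ∑ l : Fin 4, (g x)⁻¹ k l *
    (pderiv i (fun y => g y j l) x + pderiv j (fun y => g y i l) x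
      - pderiv l (fun y => g y i j) x)

/-- The covariant derivative of a covariant tensor field for the Levi-Civita connection of `g`;
the new index (the direction of differentiation) comes first:
`(∇T)_{i j₁…jₖ} = ∂ᵢ T_{j₁…jₖ} - ∑ₛ Γˡ_{i jₛ} T_{j₁…l…jₖ}`. -/
def covDeriv (g : BilinField) {k : ℕ} (T : TensorField k) : TensorField (k + 1) := fun x I =>
  pderiv (I 0) (fun y => T y (Fin.tail I)) x
    - ∑ s : Fin k, ∑ l : Fin 4,
        christoffel g x l (I 0) (Fin.tail I s) * T x (Function.update (Fin.tail I) s l)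

/-- The iterated covariant derivative `∇^ℓ T`. -/
def iterCovDeriv (g : BilinField) {k : ℕ} (T : TensorField k) : (ℓ : ℕ) → TensorField (k + ℓ)
  | 0 => T
  | ℓ + 1 => covDeriv g (iterCovDeriv g T ℓ)

/-- The pointwise norm `|T|_g` of a covariant tensor field, with
`|T|_g² = g^{i₁j₁} ⋯ g^{iₖjₖ} T_{i₁…iₖ} T_{j₁…jₖ}`. -/
def tensorNorm (g : BilinField) {k : ℕ} (T : TensorField k) (x : E4) : ℝ :=
  Real.sqrt (∑ I : Fin k → Fin 4, ∑ J : Fin k → Fin 4,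
    (∏ s : Fin k, (g x)⁻¹ (I s) (J s)) * T x I * T x J)

/-! ### The Taub-NUT metric -/

/-- The complex coordinate `z₁ = x₁ + i x₂`. -/
def z₁ (x : E4) : ℂ := ⟨x 0, x 1⟩

/-- The complex coordinate `z₂ = x₃ + i x₄`. -/
def z₂ (x : E4) : ℂ := ⟨x 2, x 3⟩

/-- The standard complex structure `I₁`, that is, multiplication by `i` in `(z₁, z₂)`. -/
def I₁ (x : E4) : E4 := !₂[-x 1, x 0, -x 3, x 2]

/-- The implicit equations `|z₁| = e^{m(u²-v²)} u`, `|z₂| = e^{m(v²-u²)} v` for the pair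
`p = (u, v)` at the point `x`. -/
def IsLeBrunPair (m : ℝ) (x : E4) (p : ℝ × ℝ) : Prop :=
  ‖z₁ x‖ = Real.exp (m * (p.1 ^ 2 - p.2 ^ 2)) * p.1 ∧
  ‖z₂ x‖ = Real.exp (m * (p.2 ^ 2 - p.1 ^ 2)) * p.2

/-- The implicit equations have exactly one solution at every point. -/
theorem existsUnique_isLeBrunPair {m : ℝ} (hm : 0 < m) (x : E4) :
    ∃! p : ℝ × ℝ, IsLeBrunPair m x p := by
  have mono : StrictMono (fun t : ℝ => t - ‖z₁ x‖ ^ 2 * Real.exp (-(2 * m * t))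
      + ‖z₂ x‖ ^ 2 * Real.exp (2 * m * t)) := by
    intro s t hst
    have h1 : Real.exp (-(2 * m * t)) ≤ Real.exp (-(2 * m * s)) :=
      Real.exp_le_exp.2 (by nlinarith)
    have h2 : Real.exp (2 * m * s) ≤ Real.exp (2 * m * t) := Real.exp_le_exp.2 (by nlinarith)
    have h3 := mul_le_mul_of_nonneg_left h1 (sq_nonneg ‖z₁ x‖)
    have h4 := mul_le_mul_of_nonneg_left h2 (sq_nonneg ‖z₂ x‖)
    show s - _ + _ < t - _ + _
    linarith
  -- every solution is recovered from the root `t = u² - v²`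
  have key : ∀ p : ℝ × ℝ, IsLeBrunPair m x p →
      p.1 = ‖z₁ x‖ * Real.exp (-(m * (p.1 ^ 2 - p.2 ^ 2))) ∧
      p.2 = ‖z₂ x‖ * Real.exp (m * (p.1 ^ 2 - p.2 ^ 2)) := by
    rintro ⟨u, v⟩ ⟨h1, h2⟩
    dsimp only at h1 h2 ⊢
    constructor
    · rw [h1, mul_right_comm, ← Real.exp_add, add_neg_cancel, Real.exp_zero, one_mul]
    · rw [h2, mul_right_comm, ← Real.exp_add,
        show m * (v ^ 2 - u ^ 2) + m * (u ^ 2 - v ^ 2) = 0 by ring, Real.exp_zero, one_mul]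
  have sq1 : ∀ t : ℝ, (‖z₁ x‖ * Real.exp (-(m * t))) ^ 2
      = ‖z₁ x‖ ^ 2 * Real.exp (-(2 * m * t)) := by
    intro t
    rw [mul_pow, ← Real.exp_nat_mul]
    congr 2
    push_cast
    ring
  have sq2 : ∀ t : ℝ, (‖z₂ x‖ * Real.exp (m * t)) ^ 2
      = ‖z₂ x‖ ^ 2 * Real.exp (2 * m * t) := by
    intro t
    rw [mul_pow, ← Real.exp_nat_mul]
    congr 2
    push_cast
    ring
  obtain ⟨t, ht⟩ : ∃ t : ℝ, t - ‖z₁ x‖ ^ 2 * Real.exp (-(2 * m * t))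
      + ‖z₂ x‖ ^ 2 * Real.exp (2 * m * t) = 0 := by
    refine mem_range_of_exists_le_of_exists_ge
      (f := fun t : ℝ => t - ‖z₁ x‖ ^ 2 * Real.exp (-(2 * m * t))
        + ‖z₂ x‖ ^ 2 * Real.exp (2 * m * t)) (by fun_prop)
      ⟨-‖z₂ x‖ ^ 2, ?_⟩ ⟨‖z₁ x‖ ^ 2, ?_⟩
    · have h1 : Real.exp (2 * m * -‖z₂ x‖ ^ 2) ≤ 1 :=
        Real.exp_le_one_iff.2 (by nlinarith [sq_nonneg ‖z₂ x‖])
      have h2 := mul_le_mul_of_nonneg_left h1 (sq_nonneg ‖z₂ x‖)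
      have h3 : 0 ≤ ‖z₁ x‖ ^ 2 * Real.exp (-(2 * m * -‖z₂ x‖ ^ 2)) := by positivity
      linarith
    · have h1 : Real.exp (-(2 * m * ‖z₁ x‖ ^ 2)) ≤ 1 :=
        Real.exp_le_one_iff.2 (by nlinarith [sq_nonneg ‖z₁ x‖])
      have h2 := mul_le_mul_of_nonneg_left h1 (sq_nonneg ‖z₁ x‖)
      have h3 : 0 ≤ ‖z₂ x‖ ^ 2 * Real.exp (2 * m * ‖z₁ x‖ ^ 2) := by positivity
      linarith
  refine ⟨(‖z₁ x‖ * Real.exp (-(m * t)), ‖z₂ x‖ * Real.exp (m * t)), ?_, ?_⟩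
  · have hdiff : (‖z₁ x‖ * Real.exp (-(m * t))) ^ 2 - (‖z₂ x‖ * Real.exp (m * t)) ^ 2 = t := by
      rw [sq1, sq2]
      linarith
    have hdiff2 : (‖z₂ x‖ * Real.exp (m * t)) ^ 2 - (‖z₁ x‖ * Real.exp (-(m * t))) ^ 2 = -t := by
      linarith
    refine ⟨?_, ?_⟩
    · dsimp only
      rw [hdiff, mul_left_comm, ← Real.exp_add, add_neg_cancel, Real.exp_zero, mul_one]
    · dsimp only
      rw [hdiff2, mul_left_comm, ← Real.exp_add, mul_neg, neg_add_cancel, Real.exp_zero, mul_one]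
  · intro p hp
    obtain ⟨k1, k2⟩ := key p hp
    have hroot : (p.1 ^ 2 - p.2 ^ 2) - ‖z₁ x‖ ^ 2 * Real.exp (-(2 * m * (p.1 ^ 2 - p.2 ^ 2)))
        + ‖z₂ x‖ ^ 2 * Real.exp (2 * m * (p.1 ^ 2 - p.2 ^ 2)) = 0 := by
      rw [← sq1, ← sq2, ← k1, ← k2]
      ring
    have heq : p.1 ^ 2 - p.2 ^ 2 = t := mono.injective (hroot.trans ht.symm)
    rw [heq] at k1 k2
    exact Prod.ext k1 k2

/-- The pair of functions `(u, v)` solving the implicit equations. -/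
def uv (m : ℝ) (x : E4) : ℝ × ℝ := Classical.epsilon (IsLeBrunPair m x)

theorem isLeBrunPair_uv {m : ℝ} (hm : 0 < m) (x : E4) : IsLeBrunPair m x (uv m x) :=
  Classical.epsilon_spec (existsUnique_isLeBrunPair hm x).exists

/-- The functions `y₁ = ½(u² - v²)` and `y₂ + i y₃ = -i z₁ z₂`. -/
def y (m : ℝ) : Fin 3 → E4 → ℝ :=
  ![fun x => (1 / 2) * ((uv m x).1 ^ 2 - (uv m x).2 ^ 2),
    fun x => (-Complex.I * z₁ x * z₂ x).re,
    fun x => (-Complex.I * z₁ x * z₂ x).im]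

/-- The function `R = ½(u² + v²)`. -/
def R (m : ℝ) (x : E4) : ℝ := (1 / 2) * ((uv m x).1 ^ 2 + (uv m x).2 ^ 2)

/-- The function `V = (1 + 4mR) / (2R)`, on `ℝ⁴ ∖ {0}`. -/
def V (m : ℝ) (x : E4) : ℝ := (1 + 4 * m * R m x) / (2 * R m x)

/-- The connection form `η = I₁ (V dy₁)`, on `ℝ⁴ ∖ {0}`, evaluated on the vector `X` at `x`;
here `I₁` acts on a one-form `β` by `I₁ β = -β(I₁ ·)`. -/
def η (m : ℝ) (x X : E4) : ℝ := -(V m x * fderiv ℝ (y m 0) x (I₁ X))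

/-- The Taub-NUT metric `f = V (dy₁² + dy₂² + dy₃²) + V⁻¹ η²` on `ℝ⁴ ∖ {0}`, extended by the
euclidean metric at the origin. -/
def taubNUT (m : ℝ) : BilinField := fun x =>
  open Classical in
  if x = 0 then 1
  else Matrix.of fun i j =>
    V m x * (∑ a : Fin 3, pderiv i (y m a) x * pderiv j (y m a) x)
      + (V m x)⁻¹ * (η m x (basisVec i) * η m x (basisVec j))

/-- The map `ℶ(z₁, z₂) = (1 + a / (κ + r⁴)) (z₁, z₂)`. -/
def beth (a κ : ℝ) (x : E4) : E4 := (1 + a / (κ + ‖x‖ ^ 4)) • x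

end TaubNUT

end

noncomputable section

namespace TaubNUT

open scoped ContDiff Topology

/-! ### The functions `y₁` and `R` -/

theorem norm_z₁_sq (x : E4) : ‖z₁ x‖ ^ 2 = x 0 ^ 2 + x 1 ^ 2 := by
  rw [← Complex.normSq_eq_norm_sq, Complex.normSq_apply]
  simp only [z₁]
  ring

theorem norm_z₂_sq (x : E4) : ‖z₂ x‖ ^ 2 = x 2 ^ 2 + x 3 ^ 2 := by
  rw [← Complex.normSq_eq_norm_sq, Complex.normSq_apply]
  simp only [z₂]
  ring

theorem norm_sq_eq (x : E4) : ‖x‖ ^ 2 = x 0 ^ 2 + x 1 ^ 2 + (x 2 ^ 2 + x 3 ^ 2) := by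
  rw [EuclideanSpace.norm_sq_eq, Fin.sum_univ_four]
  simp only [Real.norm_eq_abs, sq_abs]
  ring

/-- The weight `e^{-4 m y₁}`, for which `u² = e^{-4 m y₁} |z₁|²`. -/
def P (m : ℝ) (x : E4) : ℝ := Real.exp (-(4 * m * y m 0 x))

/-- The weight `e^{4 m y₁}`, for which `v² = e^{4 m y₁} |z₂|²`. -/
def Q (m : ℝ) (x : E4) : ℝ := Real.exp (4 * m * y m 0 x)

theorem P_pos (m : ℝ) (x : E4) : 0 < P m x := Real.exp_pos _

theorem Q_pos (m : ℝ) (x : E4) : 0 < Q m x := Real.exp_pos _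

theorem P_mul_Q (m : ℝ) (x : E4) : P m x * Q m x = 1 := by
  rw [P, Q, ← Real.exp_add, neg_add_cancel, Real.exp_zero]

theorem uv_fst_sq {m : ℝ} (hm : 0 < m) (x : E4) :
    (uv m x).1 ^ 2 = P m x * (x 0 ^ 2 + x 1 ^ 2) := by
  have h := (isLeBrunPair_uv hm x).1
  rw [← norm_z₁_sq, h, mul_pow, ← Real.exp_nat_mul, P, ← mul_assoc, ← Real.exp_add]
  have : -(4 * m * y m 0 x) + ((2 : ℕ) : ℝ) * (m * ((uv m x).1 ^ 2 - (uv m x).2 ^ 2)) = 0 := by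
    simp only [y, Matrix.cons_val_zero]
    push_cast
    ring
  rw [this, Real.exp_zero, one_mul]

theorem uv_snd_sq {m : ℝ} (hm : 0 < m) (x : E4) :
    (uv m x).2 ^ 2 = Q m x * (x 2 ^ 2 + x 3 ^ 2) := by
  have h := (isLeBrunPair_uv hm x).2
  rw [← norm_z₂_sq, h, mul_pow, ← Real.exp_nat_mul, Q, ← mul_assoc, ← Real.exp_add]
  have : 4 * m * y m 0 x + ((2 : ℕ) : ℝ) * (m * ((uv m x).2 ^ 2 - (uv m x).1 ^ 2)) = 0 := by
    simp only [y, Matrix.cons_val_zero]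
    push_cast
    ring
  rw [this, Real.exp_zero, one_mul]

theorem two_mul_y_zero {m : ℝ} (hm : 0 < m) (x : E4) :
    2 * y m 0 x = P m x * (x 0 ^ 2 + x 1 ^ 2) - Q m x * (x 2 ^ 2 + x 3 ^ 2) := by
  rw [← uv_fst_sq hm, ← uv_snd_sq hm]
  simp only [y, Matrix.cons_val_zero]
  ring

theorem two_mul_R {m : ℝ} (hm : 0 < m) (x : E4) :
    2 * R m x = P m x * (x 0 ^ 2 + x 1 ^ 2) + Q m x * (x 2 ^ 2 + x 3 ^ 2) := by
  rw [← uv_fst_sq hm, ← uv_snd_sq hm, R]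
  ring

theorem y_one (m : ℝ) (x : E4) : y m 1 x = x 0 * x 3 + x 1 * x 2 := by
  simp [y, z₁, z₂]

theorem y_two (m : ℝ) (x : E4) : y m 2 x = x 1 * x 3 - x 0 * x 2 := by
  simp [y, z₁, z₂]
  ring

theorem R_sq {m : ℝ} (hm : 0 < m) (x : E4) :
    R m x ^ 2 = y m 0 x ^ 2 + y m 1 x ^ 2 + y m 2 x ^ 2 := by
  rw [y_one, y_two]
  have h1 := two_mul_y_zero hm x
  have h2 := two_mul_R hm x
  linear_combination (1 / 4) * (2 * R m x + P m x * (x 0 ^ 2 + x 1 ^ 2)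
      + Q m x * (x 2 ^ 2 + x 3 ^ 2)) * h2
    - (1 / 4) * (2 * y m 0 x + P m x * (x 0 ^ 2 + x 1 ^ 2) - Q m x * (x 2 ^ 2 + x 3 ^ 2)) * h1
    + (x 0 ^ 2 + x 1 ^ 2) * (x 2 ^ 2 + x 3 ^ 2) * P_mul_Q m x

theorem R_nonneg (m : ℝ) (x : E4) : 0 ≤ R m x := by
  unfold R
  positivity

theorem R_pos {m : ℝ} (hm : 0 < m) {x : E4} (hx : x ≠ 0) : 0 < R m x := by
  have h := two_mul_R hm x
  have hn : 0 < ‖x‖ ^ 2 := by positivity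
  rw [norm_sq_eq] at hn
  by_contra hR
  have h1 := P_pos m x
  have h2 := Q_pos m x
  have h3 : P m x * (x 0 ^ 2 + x 1 ^ 2) ≤ 0 := by nlinarith [sq_nonneg (x 2), sq_nonneg (x 3)]
  have h4 : Q m x * (x 2 ^ 2 + x 3 ^ 2) ≤ 0 := by nlinarith [sq_nonneg (x 0), sq_nonneg (x 1)]
  have h5 : x 0 ^ 2 + x 1 ^ 2 ≤ 0 := nonpos_of_mul_nonpos_right h3 h1
  have h6 : x 2 ^ 2 + x 3 ^ 2 ≤ 0 := nonpos_of_mul_nonpos_right h4 h2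
  linarith

theorem one_add_pos {m : ℝ} (hm : 0 < m) (x : E4) : 0 < 1 + 4 * m * R m x := by
  have := R_nonneg m x
  positivity

theorem abs_y_le {m : ℝ} (hm : 0 < m) (i : Fin 3) (x : E4) : |y m i x| ≤ R m x := by
  refine abs_le_of_sq_le_sq ?_ (R_nonneg m x)
  rw [R_sq hm]
  fin_cases i <;> simp <;> nlinarith [sq_nonneg (y m 0 x), sq_nonneg (y m 1 x), sq_nonneg (y m 2 x)]

/-- The left side of the equation `2t - e^{-4mt}A + e^{4mt}B = 0`, whose root is `y₁` for
`A = |z₁|²` and `B = |z₂|²`, is strictly increasing. -/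
theorem strictMono_implicit {m A B : ℝ} (hm : 0 < m) (hA : 0 ≤ A) (hB : 0 ≤ B) :
    StrictMono fun t : ℝ => 2 * t - Real.exp (-(4 * m * t)) * A + Real.exp (4 * m * t) * B := by
  intro s t hst
  have h1 : Real.exp (-(4 * m * t)) ≤ Real.exp (-(4 * m * s)) := Real.exp_le_exp.2 (by nlinarith)
  have h2 : Real.exp (4 * m * s) ≤ Real.exp (4 * m * t) := Real.exp_le_exp.2 (by nlinarith)
  have h3 := mul_le_mul_of_nonneg_right h1 hA
  have h4 := mul_le_mul_of_nonneg_right h2 hB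
  show _ - _ + _ < _ - _ + _
  linarith

theorem eq_y_zero {m : ℝ} (hm : 0 < m) {x : E4} {t : ℝ}
    (h : 2 * t = Real.exp (-(4 * m * t)) * (x 0 ^ 2 + x 1 ^ 2)
      - Real.exp (4 * m * t) * (x 2 ^ 2 + x 3 ^ 2)) : t = y m 0 x := by
  refine (strictMono_implicit hm (A := x 0 ^ 2 + x 1 ^ 2) (B := x 2 ^ 2 + x 3 ^ 2)
    (by positivity) (by positivity)).injective ?_
  have := two_mul_y_zero hm x
  simp only [P, Q] at this
  show _ - _ + _ = _ - _ + _
  linarith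

theorem contDiff_y_zero {m : ℝ} (hm : 0 < m) : ContDiff ℝ ∞ (y m 0) := by
  rw [contDiff_iff_contDiffAt]
  intro x
  let f : E4 × ℝ → ℝ := fun u => 2 * u.2 - Real.exp (-(4 * m * u.2)) * (u.1 0 ^ 2 + u.1 1 ^ 2)
    + Real.exp (4 * m * u.2) * (u.1 2 ^ 2 + u.1 3 ^ 2)
  have hf : ContDiff ℝ ∞ f := by
    have (i : Fin 4) : ContDiff ℝ ∞ fun u : E4 × ℝ => u.1 i := by fun_prop
    fun_prop
  have hne : (∞ : WithTop ℕ∞) ≠ 0 := by simp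
  have hroot : f (x, y m 0 x) = 0 := by
    have := two_mul_y_zero hm x
    simp only [P, Q] at this
    simp only [f]
    linarith
  have hinv : (fderiv ℝ f (x, y m 0 x) ∘L .inr ℝ E4 ℝ).IsInvertible := by
    have h1 : HasFDerivAt (fun t : ℝ => f (x, t)) (fderiv ℝ f (x, y m 0 x) ∘L .inr ℝ E4 ℝ)
        (y m 0 x) :=
      ((hf.differentiable hne) (x, y m 0 x)).hasFDerivAt.comp (y m 0 x)
        (hasFDerivAt_prodMk_right x (y m 0 x))
    have h2 : HasDerivAt (fun t : ℝ => f (x, t)) (2 * (1 + 4 * m * R m x)) (y m 0 x) := by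
      have e1 : HasDerivAt (fun t : ℝ => 4 * m * t) (4 * m) (y m 0 x) := by
        simpa using (hasDerivAt_id (y m 0 x)).const_mul (4 * m)
      have := (((hasDerivAt_id (y m 0 x)).const_mul 2).sub
        (e1.neg.exp.mul_const (x 0 ^ 2 + x 1 ^ 2))).add (e1.exp.mul_const (x 2 ^ 2 + x 3 ^ 2))
      refine this.congr_deriv ?_
      have h3 := two_mul_R hm x
      simp only [P, Q] at h3
      linear_combination -4 * m * h3
    have h4 := h1.unique h2.hasFDerivAt
    rw [h4]
    have h5 := one_add_pos hm x
    refine ⟨ContinuousLinearEquiv.unitsEquivAut ℝ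
      (Units.mk0 (2 * (1 + 4 * m * R m x)) (by positivity)), ?_⟩
    ext
    simp
  let ψ := hf.contDiffAt.implicitFunction hne hinv
  have hψ : ContDiffAt ℝ ∞ ψ x := hf.contDiffAt.contDiffAt_implicitFunction hne hinv
  refine hψ.congr_of_eventuallyEq ?_
  filter_upwards [hf.contDiffAt.eventually_apply_implicitFunction hne hinv] with z hz
  rw [hroot] at hz
  refine (eq_y_zero hm ?_).symm
  simp only [f] at hz
  show 2 * ψ z = _
  linarith

/-! ### Smoothness and the coframe `dy₁, dy₂, dy₃, η` -/

theorem contDiff_P {m : ℝ} (hm : 0 < m) : ContDiff ℝ ∞ (P m) := by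
  have := contDiff_y_zero hm
  unfold P
  fun_prop

theorem contDiff_Q {m : ℝ} (hm : 0 < m) : ContDiff ℝ ∞ (Q m) := by
  have := contDiff_y_zero hm
  unfold Q
  fun_prop

theorem contDiff_coord (i : Fin 4) : ContDiff ℝ ∞ fun x : E4 => x i := by fun_prop

theorem contDiff_R {m : ℝ} (hm : 0 < m) : ContDiff ℝ ∞ (R m) := by
  have h1 := contDiff_P hm
  have h2 := contDiff_Q hm
  have h3 := contDiff_coord
  have : R m = fun x => (1 / 2) * (P m x * (x 0 ^ 2 + x 1 ^ 2) + Q m x * (x 2 ^ 2 + x 3 ^ 2)) := by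
    ext x
    rw [← two_mul_R hm]
    ring
  rw [this]
  fun_prop

/-- The coordinate form `dxᵢ`. -/
abbrev dx (i : Fin 4) : E4 →L[ℝ] ℝ := EuclideanSpace.proj i

/-- The form `(1 + 4mR) dy₁`. -/
def radialForm (m : ℝ) (x : E4) : E4 →L[ℝ] ℝ :=
  P m x • (x 0 • dx 0 + x 1 • dx 1) - Q m x • (x 2 • dx 2 + x 3 • dx 3)

/-- The form `2Rη`. -/
def angularForm (m : ℝ) (x : E4) : E4 →L[ℝ] ℝ :=
  P m x • (x 0 • dx 1 - x 1 • dx 0) - Q m x • (x 2 • dx 3 - x 3 • dx 2)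

/-- The coframe `dy₁, dy₂, dy₃, η` on `ℝ⁴ ∖ {0}`. -/
def coframe (m : ℝ) : Fin 4 → E4 → (E4 →L[ℝ] ℝ) :=
  ![fun x => (1 + 4 * m * R m x)⁻¹ • radialForm m x,
    fun x => x 0 • dx 3 + x 3 • dx 0 + (x 1 • dx 2 + x 2 • dx 1),
    fun x => x 1 • dx 3 + x 3 • dx 1 - (x 0 • dx 2 + x 2 • dx 0),
    fun x => (2 * R m x)⁻¹ • angularForm m x]

theorem radialForm_apply (m : ℝ) (x X : E4) : radialForm m x X =
    P m x * (x 0 * X 0 + x 1 * X 1) - Q m x * (x 2 * X 2 + x 3 * X 3) := by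
  simp [radialForm]
  ring

theorem angularForm_apply (m : ℝ) (x X : E4) : angularForm m x X =
    P m x * (x 0 * X 1 - x 1 * X 0) - Q m x * (x 2 * X 3 - x 3 * X 2) := by
  simp [angularForm]

theorem coframe_zero_apply (m : ℝ) (x X : E4) : coframe m 0 x X =
    (1 + 4 * m * R m x)⁻¹ *
      (P m x * (x 0 * X 0 + x 1 * X 1) - Q m x * (x 2 * X 2 + x 3 * X 3)) := by
  rw [← radialForm_apply]
  simp [coframe]

theorem coframe_one_apply (m : ℝ) (x X : E4) : coframe m 1 x X =
    x 0 * X 3 + x 3 * X 0 + (x 1 * X 2 + x 2 * X 1) := by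
  simp [coframe]

theorem coframe_two_apply (m : ℝ) (x X : E4) : coframe m 2 x X =
    x 1 * X 3 + x 3 * X 1 - (x 0 * X 2 + x 2 * X 0) := by
  simp [coframe]

theorem coframe_three_apply (m : ℝ) (x X : E4) : coframe m 3 x X =
    (2 * R m x)⁻¹ * (P m x * (x 0 * X 1 - x 1 * X 0) - Q m x * (x 2 * X 3 - x 3 * X 2)) := by
  rw [← angularForm_apply]
  simp [coframe]

theorem hasFDerivAt_coord (i : Fin 4) (x : E4) : HasFDerivAt (fun x : E4 => x i) (dx i) x :=
  (dx i).hasFDerivAt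

theorem hasFDerivAt_y_zero {m : ℝ} (hm : 0 < m) (x : E4) :
    HasFDerivAt (y m 0) (coframe m 0 x) x := by
  have hL := ((contDiff_y_zero hm).differentiable (by simp) x).hasFDerivAt
  set L := fderiv ℝ (y m 0) x
  have h4 : HasFDerivAt (fun x => 4 * m * y m 0 x) ((4 * m) • L) x := hL.const_mul _
  have c := fun i => hasFDerivAt_coord i x
  have hid : (fun x => 2 * y m 0 x) = fun x : E4 => Real.exp (-(4 * m * y m 0 x)) *
      (x 0 ^ 2 + x 1 ^ 2) - Real.exp (4 * m * y m 0 x) * (x 2 ^ 2 + x 3 ^ 2) := by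
    ext x
    exact two_mul_y_zero hm x
  have h1 : HasFDerivAt (fun x => 2 * y m 0 x) ((2 : ℝ) • L) x := hL.const_mul _
  have h2 := (h4.neg.exp.mul (((c 0).pow 2).add ((c 1).pow 2))).sub
    (h4.exp.mul (((c 2).pow 2).add ((c 3).pow 2)))
  have h3 := h1.unique (h2.congr_of_eventuallyEq (Filter.Eventually.of_forall (congrFun hid)))
  refine hL.congr_fderiv (ContinuousLinearMap.ext fun X => ?_)
  have h5 := congrArg (fun l : E4 →L[ℝ] ℝ => l X) h3
  have hK := one_add_pos hm x
  have hR := two_mul_R hm x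
  rw [coframe_zero_apply, eq_comm, inv_mul_eq_iff_eq_mul₀ hK.ne']
  simp at h5
  simp only [P, Q] at hR ⊢
  linear_combination (-1 / 2) * h5 - 2 * m * L X * hR

theorem hasFDerivAt_y {m : ℝ} (hm : 0 < m) (i : Fin 3) (x : E4) :
    HasFDerivAt (y m i) (coframe m i.castSucc x) x := by
  have c := fun i => hasFDerivAt_coord i x
  fin_cases i
  · exact hasFDerivAt_y_zero hm x
  · show HasFDerivAt (y m 1) (coframe m 1 x) x
    rw [show y m 1 = fun x => x 0 * x 3 + x 1 * x 2 from funext (y_one m)]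
    exact ((c 0).mul (c 3)).add ((c 1).mul (c 2))
  · show HasFDerivAt (y m 2) (coframe m 2 x) x
    rw [show y m 2 = fun x => x 1 * x 3 - x 0 * x 2 from funext (y_two m)]
    exact ((c 1).mul (c 3)).sub ((c 0).mul (c 2))

theorem V_eq {m : ℝ} (hm : 0 < m) {x : E4} (hx : x ≠ 0) :
    V m x = 2 * m + (2 * R m x)⁻¹ := by
  have := R_pos hm hx
  rw [V]
  field_simp
  ring

theorem η_eq {m : ℝ} (hm : 0 < m) {x : E4} (hx : x ≠ 0) (X : E4) :
    η m x X = coframe m 3 x X := by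
  have hR := R_pos hm hx
  have hK := one_add_pos hm x
  rw [η, (hasFDerivAt_y_zero hm x).fderiv, coframe_zero_apply, coframe_three_apply, V]
  simp [I₁]
  field_simp
  ring

/-- The coefficients `V, V, V, V⁻¹` of the Taub-NUT metric in the coframe. -/
def diagCoeff (m : ℝ) : Fin 4 → E4 → ℝ :=
  ![V m, V m, V m, fun x => (V m x)⁻¹]

theorem taubNUT_apply {m : ℝ} (hm : 0 < m) {x : E4} (hx : x ≠ 0) (i j : Fin 4) :
    taubNUT m x i j = ∑ a, diagCoeff m a x *
      (coframe m a x (basisVec i) * coframe m a x (basisVec j)) := by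
  rw [taubNUT, if_neg hx, Matrix.of_apply, η_eq hm hx, η_eq hm hx]
  simp only [pderiv, (hasFDerivAt_y hm _ x).fderiv, Fin.sum_univ_three, Fin.sum_univ_four]
  simp [diagCoeff]
  ring

theorem sum_forms_eq {m : ℝ} (hm : 0 < m) (x X Y : E4) :
    coframe m 1 x X * coframe m 1 x Y + coframe m 2 x X * coframe m 2 x Y
    + radialForm m x X * radialForm m x Y + angularForm m x X * angularForm m x Y
    = 2 * R m x * (P m x * (X 0 * Y 0 + X 1 * Y 1) + Q m x * (X 2 * Y 2 + X 3 * Y 3)) := by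
  rw [two_mul_R hm, coframe_one_apply, coframe_two_apply, coframe_one_apply,
    coframe_two_apply, radialForm_apply, angularForm_apply, radialForm_apply,
    angularForm_apply]
  have h := P_mul_Q m x
  linear_combination
    (-((x 0 ^ 2 + x 1 ^ 2) * (X 2 * Y 2 + X 3 * Y 3) + (x 2 ^ 2 + x 3 ^ 2) * (X 0 * Y 0 + X 1 * Y 1)
      + (x 0 * X 0 + x 1 * X 1) * (x 2 * Y 2 + x 3 * Y 3)
      + (x 0 * Y 0 + x 1 * Y 1) * (x 2 * X 2 + x 3 * X 3)
      + (x 0 * X 1 - x 1 * X 0) * (x 2 * Y 3 - x 3 * Y 2)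
      + (x 0 * Y 1 - x 1 * Y 0) * (x 2 * X 3 - x 3 * X 2))) * h

/-- The components of the Taub-NUT metric in a form which is smooth across the origin. -/
theorem taubNUT_smooth_form {m : ℝ} (hm : 0 < m) (x : E4) (i j : Fin 4) :
    taubNUT m x i j =
      P m x * (basisVec i 0 * basisVec j 0 + basisVec i 1 * basisVec j 1)
      + Q m x * (basisVec i 2 * basisVec j 2 + basisVec i 3 * basisVec j 3)
      + 2 * m * (coframe m 1 x (basisVec i) * coframe m 1 x (basisVec j)
        + coframe m 2 x (basisVec i) * coframe m 2 x (basisVec j))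
      - 2 * m * (1 + 4 * m * R m x)⁻¹ * (radialForm m x (basisVec i) * radialForm m x (basisVec j)
        + angularForm m x (basisVec i) * angularForm m x (basisVec j)) := by
  by_cases hx : x = 0
  · subst hx
    have h0 : y m 0 0 = 0 := by
      have := two_mul_y_zero hm 0
      simpa using this
    rw [taubNUT, if_pos rfl, coframe_one_apply, coframe_two_apply, coframe_one_apply,
      coframe_two_apply, radialForm_apply, angularForm_apply, radialForm_apply, angularForm_apply]
    simp only [P, Q, h0]
    fin_cases i <;> fin_cases j <;> simp [basisVec]
  · have hR := R_pos hm hx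
    have hK := one_add_pos hm x
    rw [taubNUT_apply hm hx]
    generalize basisVec i = X
    generalize basisVec j = Y
    have key := sum_forms_eq hm x X Y
    simp only [Fin.sum_univ_four, diagCoeff, Matrix.cons_val, V]
    have e0 : ∀ Z, coframe m 0 x Z = (1 + 4 * m * R m x)⁻¹ * radialForm m x Z := fun Z => rfl
    have e3 : ∀ Z, coframe m 3 x Z = (2 * R m x)⁻¹ * angularForm m x Z := fun Z => rfl
    rw [e0, e3, e0, e3]
    field_simp
    linear_combination (1 + 4 * m * R m x) * key

/-! ### Tensor calculus in a coframe in which the metric is diagonal -/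

/-- The connection coefficients of the metric `∑ d_c θᶜ ⊗ θᶜ` in the coframe `θ`, where
`d' c b` are the components of the differential of `d_c` and `τ c a b` those of `dθᶜ`. -/
def connCoeff (d : Fin 4 → ℝ) (d' : Fin 4 → Fin 4 → ℝ) (τ : Fin 4 → Fin 4 → Fin 4 → ℝ)
    (c a b : Fin 4) : ℝ :=
  (d c)⁻¹ * ((1 / 2) * ((if b = c then d' c a else 0) + (if a = c then d' c b else 0)
    - (if a = b then d' a c else 0) - d c * τ c a b + d b * τ b a c + d a * τ a b c))

theorem koszul_identity {Θ : Fin 4 → Fin 4 → ℝ} {d : Fin 4 → ℝ} {d' : Fin 4 → Fin 4 → ℝ}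
    {τ D : Fin 4 → Fin 4 → Fin 4 → ℝ} (hd : ∀ c, d c ≠ 0)
    (hτ : ∀ c i j, D i c j - D j c i = ∑ a, ∑ b, τ c a b * (Θ a i * Θ b j)) (i j l : Fin 4) :
    (∑ c, ((∑ b, d' c b * Θ b i) * (Θ c j * Θ c l) + d c * (D i c j * Θ c l + Θ c j * D i c l)))
    + (∑ c, ((∑ b, d' c b * Θ b j) * (Θ c i * Θ c l) + d c * (D j c i * Θ c l + Θ c i * D j c l)))
    - (∑ c, ((∑ b, d' c b * Θ b l) * (Θ c i * Θ c j) + d c * (D l c i * Θ c j + Θ c i * D l c j)))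
    = 2 * ∑ c, d c * Θ c l * (D i c j + ∑ a, ∑ b, connCoeff d d' τ c a b * (Θ a i * Θ b j)) := by
  have hγ : ∀ c, d c * Θ c l * ∑ a, ∑ b, connCoeff d d' τ c a b * (Θ a i * Θ b j)
      = (1 / 2) * ((∑ a, ∑ b, (if b = c then d' c a else 0) * (Θ c l * Θ a i * Θ b j))
        + (∑ a, ∑ b, (if a = c then d' c b else 0) * (Θ c l * Θ a i * Θ b j))
        - (∑ a, ∑ b, (if a = b then d' a c else 0) * (Θ c l * Θ a i * Θ b j))
        - (∑ a, ∑ b, d c * τ c a b * (Θ c l * Θ a i * Θ b j))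
        + (∑ a, ∑ b, d b * τ b a c * (Θ c l * Θ a i * Θ b j))
        + (∑ a, ∑ b, d a * τ a b c * (Θ c l * Θ a i * Θ b j))) := by
    intro c
    simp only [← Finset.sum_add_distrib, ← Finset.sum_sub_distrib, Finset.mul_sum]
    refine Finset.sum_congr rfl fun a _ => Finset.sum_congr rfl fun b _ => ?_
    rw [connCoeff]
    have := hd c
    field_simp
  have s1 : ∑ c, ∑ a, ∑ b, (if b = c then d' c a else 0) * (Θ c l * Θ a i * Θ b j)
      = ∑ c, (∑ b, d' c b * Θ b i) * (Θ c j * Θ c l) := by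
    refine Finset.sum_congr rfl fun c _ => ?_
    rw [Finset.sum_mul]
    refine Finset.sum_congr rfl fun a _ => ?_
    simp only [ite_mul, zero_mul, Finset.sum_ite_eq', Finset.mem_univ, if_true]
    ring
  have s2 : ∑ c, ∑ a, ∑ b, (if a = c then d' c b else 0) * (Θ c l * Θ a i * Θ b j)
      = ∑ c, (∑ b, d' c b * Θ b j) * (Θ c i * Θ c l) := by
    refine Finset.sum_congr rfl fun c _ => ?_
    rw [Finset.sum_mul, Finset.sum_comm]
    refine Finset.sum_congr rfl fun b _ => ?_
    simp only [ite_mul, zero_mul, Finset.sum_ite_eq', Finset.mem_univ, if_true]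
    ring
  have s3 : ∑ c, ∑ a, ∑ b, (if a = b then d' a c else 0) * (Θ c l * Θ a i * Θ b j)
      = ∑ c, (∑ b, d' c b * Θ b l) * (Θ c i * Θ c j) := by
    rw [Finset.sum_comm]
    refine Finset.sum_congr rfl fun a _ => ?_
    rw [Finset.sum_mul]
    refine Finset.sum_congr rfl fun c _ => ?_
    simp only [ite_mul, zero_mul, Finset.sum_ite_eq, Finset.mem_univ, if_true]
    ring
  have s4 : ∑ c, ∑ a, ∑ b, d c * τ c a b * (Θ c l * Θ a i * Θ b j)
      = ∑ c, d c * Θ c l * (D i c j - D j c i) := by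
    refine Finset.sum_congr rfl fun c _ => ?_
    rw [hτ, Finset.mul_sum]
    refine Finset.sum_congr rfl fun a _ => ?_
    rw [Finset.mul_sum]
    exact Finset.sum_congr rfl fun b _ => by ring
  have s5 : ∑ c, ∑ a, ∑ b, d b * τ b a c * (Θ c l * Θ a i * Θ b j)
      = ∑ c, d c * Θ c j * (D i c l - D l c i) := by
    have : ∑ c, ∑ a, ∑ b, d b * τ b a c * (Θ c l * Θ a i * Θ b j)
        = ∑ b, ∑ a, ∑ c, d b * τ b a c * (Θ c l * Θ a i * Θ b j) := by
      rw [Finset.sum_comm]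
      simp_rw [fun a => Finset.sum_comm (s := Finset.univ) (t := Finset.univ)
        (f := fun c b => d b * τ b a c * (Θ c l * Θ a i * Θ b j))]
      rw [Finset.sum_comm]
    rw [this]
    refine Finset.sum_congr rfl fun b _ => ?_
    rw [hτ, Finset.mul_sum]
    refine Finset.sum_congr rfl fun a _ => ?_
    rw [Finset.mul_sum]
    exact Finset.sum_congr rfl fun c _ => by ring
  have s6 : ∑ c, ∑ a, ∑ b, d a * τ a b c * (Θ c l * Θ a i * Θ b j)
      = ∑ c, d c * Θ c i * (D j c l - D l c j) := by
    rw [Finset.sum_comm]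
    refine Finset.sum_congr rfl fun a _ => ?_
    rw [hτ, Finset.mul_sum, Finset.sum_comm]
    refine Finset.sum_congr rfl fun b _ => ?_
    rw [Finset.mul_sum]
    exact Finset.sum_congr rfl fun c _ => by ring
  simp only [mul_add (d _ * Θ _ l), hγ]
  simp only [Finset.sum_add_distrib, ← Finset.mul_sum, Finset.sum_sub_distrib, s1, s2, s3, s4, s5,
    s6]
  simp only [Finset.mul_sum, ← Finset.sum_add_distrib, ← Finset.sum_sub_distrib]
  exact Finset.sum_congr rfl fun c _ => by ring

/-- The matrix of a coframe. -/
def coMatrix (θ : Fin 4 → E4 → (E4 →L[ℝ] ℝ)) (x : E4) : Matrix (Fin 4) (Fin 4) ℝ :=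
  Matrix.of fun a i => θ a x (basisVec i)

section Coframe

variable {g : BilinField} {θ : Fin 4 → E4 → (E4 →L[ℝ] ℝ)} {d : Fin 4 → E4 → ℝ} {Ω : Set E4}

theorem sum_inv_mul_coframe {x : E4}
    (hg : ∀ i j, g x i j = ∑ a, d a x * (θ a x (basisVec i) * θ a x (basisVec j)))
    (hd : ∀ a, d a x ≠ 0) (hθ : IsUnit (coMatrix θ x).det) (a b : Fin 4) :
    ∑ i, ∑ j, (g x)⁻¹ i j * (θ a x (basisVec i) * θ b x (basisVec j))
      = if a = b then (d a x)⁻¹ else 0 := by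
  set Θ := coMatrix θ x
  have h1 : g x = Θ.transpose * Matrix.diagonal (fun a => d a x) * Θ := by
    ext i j
    rw [hg, Matrix.mul_apply]
    refine Finset.sum_congr rfl fun a _ => ?_
    rw [Matrix.mul_diagonal]
    simp [Θ, coMatrix]
    ring
  have hd1 : Matrix.diagonal (fun a => (d a x)⁻¹) * Matrix.diagonal (fun a => d a x) = 1 := by
    rw [Matrix.diagonal_mul_diagonal, ← Matrix.diagonal_one]
    congr 1
    ext a
    exact inv_mul_cancel₀ (hd a)
  have hu : IsUnit Θ.transpose.det := by rwa [Matrix.det_transpose]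
  have h2 : (g x)⁻¹ = Θ⁻¹ * Matrix.diagonal (fun a => (d a x)⁻¹) * Θ.transpose⁻¹ := by
    refine Matrix.inv_eq_left_inv ?_
    rw [h1]
    calc _ = Θ⁻¹ * Matrix.diagonal (fun a => (d a x)⁻¹) * (Θ.transpose⁻¹ * Θ.transpose)
          * Matrix.diagonal (fun a => d a x) * Θ := by simp only [Matrix.mul_assoc]
      _ = Θ⁻¹ * (Matrix.diagonal (fun a => (d a x)⁻¹) * Matrix.diagonal (fun a => d a x)) * Θ := by
          rw [Matrix.nonsing_inv_mul _ hu]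
          simp only [Matrix.mul_assoc, Matrix.one_mul]
      _ = 1 := by rw [hd1, Matrix.mul_one, Matrix.nonsing_inv_mul _ hθ]
  have h3 : Θ * (g x)⁻¹ * Θ.transpose = Matrix.diagonal (fun a => (d a x)⁻¹) := by
    rw [h2]
    calc _ = (Θ * Θ⁻¹) * Matrix.diagonal (fun a => (d a x)⁻¹) * (Θ.transpose⁻¹ * Θ.transpose) := by
          simp only [Matrix.mul_assoc]
      _ = _ := by
          rw [Matrix.nonsing_inv_mul _ hu, Matrix.mul_nonsing_inv _ hθ, Matrix.one_mul,
            Matrix.mul_one]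
  have h4 := congrFun (congrFun h3 a) b
  rw [Matrix.diagonal_apply, Matrix.mul_apply] at h4
  rw [← h4, Finset.sum_comm]
  refine Finset.sum_congr rfl fun j _ => ?_
  rw [Matrix.mul_apply, Finset.sum_mul]
  refine Finset.sum_congr rfl fun i _ => ?_
  simp [Θ, coMatrix]
  ring

theorem sum_inv_mul_lower {x : E4}
    (hg : ∀ i j, g x i j = ∑ a, d a x * (θ a x (basisVec i) * θ a x (basisVec j)))
    (hd : ∀ a, d a x ≠ 0) (hθ : IsUnit (coMatrix θ x).det) (c : Fin 4) (s : Fin 4 → ℝ) :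
    ∑ k, (∑ l, (g x)⁻¹ k l * ∑ b, d b x * θ b x (basisVec l) * s b) * θ c x (basisVec k)
      = s c := by
  have h : ∑ k, (∑ l, (g x)⁻¹ k l * ∑ b, d b x * θ b x (basisVec l) * s b) * θ c x (basisVec k)
      = ∑ b, (d b x * s b) *
        ∑ k, ∑ l, (g x)⁻¹ k l * (θ c x (basisVec k) * θ b x (basisVec l)) := by
    simp only [Finset.mul_sum, Finset.sum_mul]
    conv_lhs => enter [2, k]; rw [Finset.sum_comm]
    rw [Finset.sum_comm]
    refine Finset.sum_congr rfl fun b _ => Finset.sum_congr rfl fun k _ =>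
      Finset.sum_congr rfl fun l _ => by ring
  rw [h]
  simp only [sum_inv_mul_coframe hg hd hθ, mul_ite, mul_zero, Finset.sum_ite_eq, Finset.mem_univ,
    if_true]
  have := hd c
  field_simp

/-- The Christoffel symbols contracted with a coframe in which the metric is diagonal. -/
theorem christoffel_contract {d' : Fin 4 → Fin 4 → E4 → ℝ}
    {τ : Fin 4 → Fin 4 → Fin 4 → E4 → ℝ} (hΩ : IsOpen Ω)
    (hg : ∀ x ∈ Ω, ∀ i j, g x i j = ∑ a, d a x * (θ a x (basisVec i) * θ a x (basisVec j)))
    (hd : ∀ x ∈ Ω, ∀ a, d a x ≠ 0) (hu : ∀ x ∈ Ω, IsUnit (coMatrix θ x).det)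
    (hd' : ∀ x ∈ Ω, ∀ a, HasFDerivAt (d a) (∑ b, d' a b x • θ b x) x)
    (hθ : ∀ x ∈ Ω, ∀ a i, DifferentiableAt ℝ (fun z => θ a z (basisVec i)) x)
    (hτ : ∀ x ∈ Ω, ∀ c i j, pderiv i (fun z => θ c z (basisVec j)) x
      - pderiv j (fun z => θ c z (basisVec i)) x
      = ∑ a, ∑ b, τ c a b x * (θ a x (basisVec i) * θ b x (basisVec j)))
    {x : E4} (hx : x ∈ Ω) (c i j : Fin 4) :
    ∑ k, christoffel g x k i j * θ c x (basisVec k) = pderiv i (fun z => θ c z (basisVec j)) x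
      + ∑ a, ∑ b, connCoeff (fun c => d c x) (fun c b => d' c b x) (fun c a b => τ c a b x) c a b
        * (θ a x (basisVec i) * θ b x (basisVec j)) := by
  have hpd : ∀ i j l, pderiv i (fun z => g z j l) x
      = ∑ c, ((∑ b, d' c b x * θ b x (basisVec i)) * (θ c x (basisVec j) * θ c x (basisVec l))
        + d c x * (pderiv i (fun z => θ c z (basisVec j)) x * θ c x (basisVec l)
          + θ c x (basisVec j) * pderiv i (fun z => θ c z (basisVec l)) x)) := by
    intro i j l
    have h1 : (fun z => g z j l) =ᶠ[𝓝 x]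
        fun z => ∑ a, d a z * (θ a z (basisVec j) * θ a z (basisVec l)) := by
      filter_upwards [hΩ.mem_nhds hx] with z hz using hg z hz j l
    have h2 : HasFDerivAt (fun z => ∑ a, d a z * (θ a z (basisVec j) * θ a z (basisVec l))) _ x :=
      HasFDerivAt.fun_sum fun a (_ : a ∈ Finset.univ) =>
        (hd' x hx a).mul ((hθ x hx a j).hasFDerivAt.mul (hθ x hx a l).hasFDerivAt)
    rw [pderiv, h1.fderiv_eq, h2.fderiv]
    simp only [sum_apply, add_apply,
      smul_apply, smul_eq_mul, pderiv]
    refine Finset.sum_congr rfl fun c _ => ?_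
    ring
  have h := fun l => koszul_identity (Θ := fun a i => θ a x (basisVec i)) (d := fun c => d c x)
    (d' := fun c b => d' c b x) (τ := fun c a b => τ c a b x)
    (D := fun i c j => pderiv i (fun z => θ c z (basisVec j)) x) (hd x hx) (hτ x hx) i j l
  have h3 : ∀ k, christoffel g x k i j = ∑ l, (g x)⁻¹ k l * ∑ c, d c x * θ c x (basisVec l) *
      (pderiv i (fun z => θ c z (basisVec j)) x + ∑ a, ∑ b,
        connCoeff (fun c => d c x) (fun c b => d' c b x) (fun c a b => τ c a b x) c a b
        * (θ a x (basisVec i) * θ b x (basisVec j))) := by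
    intro k
    rw [christoffel, Finset.mul_sum]
    refine Finset.sum_congr rfl fun l _ => ?_
    rw [hpd, hpd, hpd, h]
    ring
  simp only [h3]
  exact sum_inv_mul_lower (hg x hx) (hd x hx) (hu x hx) c _

/-- The components of a covariant tensor field in a coframe on a set. -/
def HasComps (θ : Fin 4 → E4 → (E4 →L[ℝ] ℝ)) (Ω : Set E4) {k : ℕ} (T : TensorField k)
    (t : (Fin k → Fin 4) → E4 → ℝ) : Prop :=
  ∀ x ∈ Ω, ∀ I, T x I = ∑ A, t A x * ∏ s, θ (A s) x (basisVec (I s))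

theorem tensorNorm_eq {k : ℕ} {T : TensorField k} {t : (Fin k → Fin 4) → E4 → ℝ}
    (hT : HasComps θ Ω T t) {x : E4} (hx : x ∈ Ω)
    (hg : ∀ i j, g x i j = ∑ a, d a x * (θ a x (basisVec i) * θ a x (basisVec j)))
    (hd : ∀ a, d a x ≠ 0) (hθ : IsUnit (coMatrix θ x).det) :
    tensorNorm g T x = Real.sqrt (∑ A, (∏ s, (d (A s) x)⁻¹) * t A x ^ 2) := by
  rw [tensorNorm]
  congr 1
  have h1 : ∀ A B : Fin k → Fin 4, ∑ I : Fin k → Fin 4, ∑ J : Fin k → Fin 4,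
      (∏ s, (g x)⁻¹ (I s) (J s)) * (∏ s, θ (A s) x (basisVec (I s))) *
        (∏ s, θ (B s) x (basisVec (J s)))
      = if A = B then ∏ s, (d (A s) x)⁻¹ else 0 := by
    intro A B
    have h2 : ∏ s, ∑ i, ∑ j, (g x)⁻¹ i j * (θ (A s) x (basisVec i) * θ (B s) x (basisVec j))
        = ∑ I : Fin k → Fin 4, ∑ J : Fin k → Fin 4, (∏ s, (g x)⁻¹ (I s) (J s)) *
          (∏ s, θ (A s) x (basisVec (I s))) * (∏ s, θ (B s) x (basisVec (J s))) := by
      rw [Finset.prod_univ_sum, Fintype.piFinset_univ]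
      refine Finset.sum_congr rfl fun I _ => ?_
      rw [Finset.prod_univ_sum, Fintype.piFinset_univ]
      refine Finset.sum_congr rfl fun J _ => ?_
      rw [← Finset.prod_mul_distrib, ← Finset.prod_mul_distrib]
      exact Finset.prod_congr rfl fun s _ => by ring
    rw [← h2]
    simp only [sum_inv_mul_coframe hg hd hθ]
    by_cases hAB : A = B
    · subst hAB
      simp
    · obtain ⟨s, hs⟩ := Function.ne_iff.1 hAB
      rw [if_neg hAB]
      exact Finset.prod_eq_zero (Finset.mem_univ s) (if_neg hs)
  calc _ = ∑ I : Fin k → Fin 4, ∑ J : Fin k → Fin 4, ∑ A, ∑ B, t A x * t B x *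
        ((∏ s, (g x)⁻¹ (I s) (J s)) * (∏ s, θ (A s) x (basisVec (I s))) *
        (∏ s, θ (B s) x (basisVec (J s)))) := by
        refine Finset.sum_congr rfl fun I _ => Finset.sum_congr rfl fun J _ => ?_
        rw [hT x hx, hT x hx, mul_assoc, Finset.sum_mul_sum, Finset.mul_sum]
        refine Finset.sum_congr rfl fun A _ => ?_
        rw [Finset.mul_sum]
        exact Finset.sum_congr rfl fun B _ => by ring
    _ = ∑ A, ∑ B, t A x * t B x * ∑ I : Fin k → Fin 4, ∑ J : Fin k → Fin 4,
        ((∏ s, (g x)⁻¹ (I s) (J s)) * (∏ s, θ (A s) x (basisVec (I s))) *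
        (∏ s, θ (B s) x (basisVec (J s)))) := by
        simp only [Finset.mul_sum]
        conv_lhs => enter [2, I]; rw [Finset.sum_comm]
        rw [Finset.sum_comm]
        refine Finset.sum_congr rfl fun A _ => ?_
        conv_lhs => enter [2, I]; rw [Finset.sum_comm]
        rw [Finset.sum_comm]
    _ = _ := by
        simp only [h1, mul_ite, mul_zero, Finset.sum_ite_eq, Finset.mem_univ, if_true]
        exact Finset.sum_congr rfl fun A _ => by ring

/-- The covariant derivative in terms of the components in a coframe. -/
theorem HasComps.covDeriv {γ : Fin 4 → Fin 4 → Fin 4 → E4 → ℝ} (hΩ : IsOpen Ω)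
    (hθ : ∀ x ∈ Ω, ∀ a i, DifferentiableAt ℝ (fun z => θ a z (basisVec i)) x)
    (hγ : ∀ x ∈ Ω, ∀ c i j, ∑ k, christoffel g x k i j * θ c x (basisVec k)
      = pderiv i (fun z => θ c z (basisVec j)) x
        + ∑ a, ∑ b, γ c a b x * (θ a x (basisVec i) * θ b x (basisVec j)))
    {k : ℕ} {T : TensorField k} {t : (Fin k → Fin 4) → E4 → ℝ}
    {t' : (Fin k → Fin 4) → Fin 4 → E4 → ℝ} (hT : HasComps θ Ω T t)
    (ht : ∀ x ∈ Ω, ∀ A, HasFDerivAt (t A) (∑ a, t' A a x • θ a x) x) :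
    HasComps θ Ω (TaubNUT.covDeriv g T) fun A x => t' (Fin.tail A) (A 0) x
      - ∑ s : Fin k, ∑ c, γ c (A 0) (Fin.tail A s) x * t (Function.update (Fin.tail A) s c) x := by
  intro x hx I
  set i := I 0 with hi
  set J := Fin.tail I with hJ
  let Θ : Fin 4 → Fin 4 → ℝ := fun a i => θ a x (basisVec i)
  let D : Fin 4 → Fin 4 → ℝ := fun c j => pderiv i (fun z => θ c z (basisVec j)) x
  let E : (Fin k → Fin 4) → Fin k → ℝ := fun A s => ∏ r ∈ Finset.univ.erase s, Θ (A r) (J r)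
  have hE : ∀ A s, ∏ r, Θ (A r) (J r) = Θ (A s) (J s) * E A s := fun A s =>
    (Finset.mul_prod_erase Finset.univ (fun r => Θ (A r) (J r)) (Finset.mem_univ s)).symm
  have h1 : pderiv i (fun z => T z J) x = ∑ A, ((∑ a, t' A a x * Θ a i) * ∏ r, Θ (A r) (J r)
      + t A x * ∑ s, D (A s) (J s) * E A s) := by
    have h2 : (fun z => T z J) =ᶠ[𝓝 x]
        fun z => ∑ A, t A z * ∏ s, θ (A s) z (basisVec (J s)) := by
      filter_upwards [hΩ.mem_nhds hx] with z hz using hT z hz J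
    have h3 : HasFDerivAt (fun z => ∑ A, t A z * ∏ s, θ (A s) z (basisVec (J s))) _ x :=
      HasFDerivAt.fun_sum fun A (_ : A ∈ Finset.univ) => (ht x hx A).mul
        (HasFDerivAt.finsetProd fun s (_ : s ∈ Finset.univ) =>
          (hθ x hx (A s) (J s)).hasFDerivAt)
    rw [pderiv, h2.fderiv_eq, h3.fderiv]
    simp only [sum_apply, add_apply,
      smul_apply, smul_eq_mul]
    refine Finset.sum_congr rfl fun A _ => ?_
    rw [add_comm, mul_comm (∏ r, _)]
    congr 2
    exact Finset.sum_congr rfl fun s _ => mul_comm _ _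
  have h4 : ∀ s, ∑ l, christoffel g x l i (J s) * T x (Function.update J s l)
      = ∑ A, t A x * ((D (A s) (J s) + ∑ a, ∑ b, γ (A s) a b x * (Θ a i * Θ b (J s))) * E A s) := by
    intro s
    have h5 : ∀ l A, ∏ r, θ (A r) x (basisVec (Function.update J s l r)) = Θ (A s) l * E A s := by
      intro l A
      rw [← Finset.mul_prod_erase Finset.univ _ (Finset.mem_univ s), Function.update_self]
      congr 1
      refine Finset.prod_congr rfl fun r hr => ?_
      rw [Function.update_of_ne (Finset.ne_of_mem_erase hr)]
    calc _ = ∑ l, ∑ A, t A x * (christoffel g x l i (J s) * Θ (A s) l * E A s) := by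
          refine Finset.sum_congr rfl fun l _ => ?_
          rw [hT x hx, Finset.mul_sum]
          refine Finset.sum_congr rfl fun A _ => ?_
          rw [h5]
          ring
      _ = _ := by
          rw [Finset.sum_comm]
          refine Finset.sum_congr rfl fun A _ => ?_
          rw [← Finset.mul_sum, ← Finset.sum_mul, hγ x hx]
  have h6 : ∀ s a, ∑ A : Fin k → Fin 4, ∑ c, γ c a (A s) x * t (Function.update A s c) x
        * (Θ (A s) (J s) * E A s)
      = ∑ A : Fin k → Fin 4, ∑ b, γ (A s) a b x * t A x * (Θ b (J s) * E A s) := by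
    intro s a
    rw [← Fintype.sum_prod_type', ← Fintype.sum_prod_type']
    have hinv : Function.Involutive fun q : (Fin k → Fin 4) × Fin 4 =>
        (Function.update q.1 s q.2, q.1 s) := by
      rintro ⟨A, c⟩
      simp
    refine Fintype.sum_equiv hinv.toPerm _ _ ?_
    rintro ⟨A, c⟩
    have hE' : E (Function.update A s c) s = E A s :=
      Finset.prod_congr rfl fun r hr => by
        rw [Function.update_of_ne (Finset.ne_of_mem_erase hr)]
    simp only [Function.Involutive.coe_toPerm, Function.update_self, hE']
  show pderiv i (fun z => T z J) x - ∑ s, ∑ l, christoffel g x l i (J s) *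
    T x (Function.update J s l) = _
  rw [h1]
  simp only [h4]
  rw [← (Fin.consEquiv fun _ => Fin 4).sum_comp, Fintype.sum_prod_type]
  have h7 : ∀ a (A : Fin k → Fin 4),
      ∏ s, θ ((Fin.consEquiv fun _ => Fin 4) (a, A) s) x (basisVec (I s))
      = Θ a i * ∏ r, Θ (A r) (J r) := by
    intro a A
    rw [Fin.prod_univ_succ]
    rfl
  have h8 : ∀ a (A : Fin k → Fin 4), (Fin.consEquiv fun _ => Fin 4) (a, A) 0 = a := fun a A => rfl
  have h9 : ∀ a (A : Fin k → Fin 4), Fin.tail ((Fin.consEquiv fun _ => Fin 4) (a, A)) = A :=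
    fun a A => rfl
  simp only [h7, h8, h9]
  have hR : ∑ a, ∑ A : Fin k → Fin 4, (t' A a x
      - ∑ s, ∑ c, γ c a (A s) x * t (Function.update A s c) x) * (Θ a i * ∏ r, Θ (A r) (J r))
      = (∑ A, (∑ a, t' A a x * Θ a i) * ∏ r, Θ (A r) (J r))
        - ∑ s, ∑ a, Θ a i * ∑ A : Fin k → Fin 4, ∑ c, γ c a (A s) x
          * t (Function.update A s c) x * (Θ (A s) (J s) * E A s) := by
    simp only [sub_mul, Finset.sum_sub_distrib]
    congr 1
    · rw [Finset.sum_comm]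
      refine Finset.sum_congr rfl fun A _ => ?_
      rw [Finset.sum_mul]
      exact Finset.sum_congr rfl fun a _ => by ring
    · rw [Finset.sum_comm (s := (Finset.univ : Finset (Fin k)))]
      refine Finset.sum_congr rfl fun a _ => ?_
      rw [← Finset.mul_sum, Finset.sum_comm, Finset.mul_sum]
      refine Finset.sum_congr rfl fun A _ => ?_
      rw [Finset.sum_mul, Finset.mul_sum]
      refine Finset.sum_congr rfl fun s _ => ?_
      rw [Finset.sum_mul, Finset.mul_sum]
      refine Finset.sum_congr rfl fun c _ => ?_
      rw [hE A s]
      ring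
  rw [hR]
  simp only [h6]
  have hL : ∀ s, ∑ A, t A x * ((D (A s) (J s)
      + ∑ a, ∑ b, γ (A s) a b x * (Θ a i * Θ b (J s))) * E A s)
      = ∑ A, t A x * (D (A s) (J s) * E A s) + ∑ a, Θ a i * ∑ A : Fin k → Fin 4, ∑ b,
        γ (A s) a b x * t A x * (Θ b (J s) * E A s) := by
    intro s
    simp only [Finset.mul_sum, Finset.sum_mul, add_mul, mul_add, Finset.sum_add_distrib]
    congr 1
    rw [Finset.sum_comm]
    refine Finset.sum_congr rfl fun a _ => Finset.sum_congr rfl fun A _ =>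
      Finset.sum_congr rfl fun b _ => by ring
  simp only [hL, Finset.sum_add_distrib, Finset.mul_sum (s := (Finset.univ : Finset (Fin k)))]
  rw [Finset.sum_comm (s := (Finset.univ : Finset (Fin k)))
    (f := fun s A => t A x * (D (A s) (J s) * E A s))]
  ring

end Coframe

/-! ### Smooth tensor fields -/

theorem contDiff_pderiv {F : E4 → ℝ} (hF : ContDiff ℝ ∞ F) (i : Fin 4) :
    ContDiff ℝ ∞ (pderiv i F) :=
  (hF.fderiv_right (m := ∞) le_rfl).clm_apply contDiff_const

theorem contDiff_det {M : E4 → Matrix (Fin 4) (Fin 4) ℝ}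
    (hM : ∀ i j, ContDiff ℝ ∞ fun x => M x i j) : ContDiff ℝ ∞ fun x => (M x).det := by
  simp only [Matrix.det_apply]
  refine ContDiff.sum fun σ _ => ContDiff.const_smul _ ?_
  exact contDiff_prod fun i _ => hM _ _

theorem contDiff_matrix_inv {M : E4 → Matrix (Fin 4) (Fin 4) ℝ}
    (hM : ∀ i j, ContDiff ℝ ∞ fun x => M x i j) (hdet : ∀ x, (M x).det ≠ 0) (i j : Fin 4) :
    ContDiff ℝ ∞ fun x => (M x)⁻¹ i j := by
  simp only [Matrix.inv_def, Ring.inverse_eq_inv', Matrix.smul_apply, smul_eq_mul,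
    Matrix.adjugate_apply]
  refine ((contDiff_det hM).inv hdet).mul (contDiff_det fun k l => ?_)
  by_cases hk : k = j
  · subst hk
    simpa using contDiff_const
  · simpa [hk] using hM k l

section

variable {g : BilinField}

theorem contDiff_christoffel (hg : ∀ i j, ContDiff ℝ ∞ fun x => g x i j)
    (hdet : ∀ x, (g x).det ≠ 0) (k i j : Fin 4) :
    ContDiff ℝ ∞ fun x => christoffel g x k i j := by
  refine contDiff_const.mul (ContDiff.sum fun l _ => (contDiff_matrix_inv hg hdet k l).mul ?_)
  exact ((contDiff_pderiv (hg j l) i).add (contDiff_pderiv (hg i l) j)).sub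
    (contDiff_pderiv (hg i j) l)

theorem contDiff_covDeriv (hg : ∀ i j, ContDiff ℝ ∞ fun x => g x i j)
    (hdet : ∀ x, (g x).det ≠ 0) {k : ℕ} {T : TensorField k}
    (hT : ∀ I, ContDiff ℝ ∞ fun x => T x I) (I : Fin (k + 1) → Fin 4) :
    ContDiff ℝ ∞ fun x => covDeriv g T x I :=
  (contDiff_pderiv (hT _) _).sub <| ContDiff.sum fun _ _ => ContDiff.sum fun _ _ =>
    (contDiff_christoffel hg hdet _ _ _).mul (hT _)

theorem contDiff_iterCovDeriv (hg : ∀ i j, ContDiff ℝ ∞ fun x => g x i j)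
    (hdet : ∀ x, (g x).det ≠ 0) {k : ℕ} {T : TensorField k}
    (hT : ∀ I, ContDiff ℝ ∞ fun x => T x I) :
    ∀ (ℓ : ℕ) (I : Fin (k + ℓ) → Fin 4), ContDiff ℝ ∞ fun x => iterCovDeriv g T ℓ x I
  | 0 => hT
  | ℓ + 1 => contDiff_covDeriv hg hdet (contDiff_iterCovDeriv hg hdet hT ℓ)

theorem continuous_tensorNorm (hg : ∀ i j, ContDiff ℝ ∞ fun x => g x i j)
    (hdet : ∀ x, (g x).det ≠ 0) {k : ℕ} {T : TensorField k}
    (hT : ∀ I, ContDiff ℝ ∞ fun x => T x I) : Continuous (tensorNorm g T) := by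
  refine Real.continuous_sqrt.comp ?_
  refine continuous_finsetSum _ fun I _ => continuous_finsetSum _ fun J _ => ?_
  refine Continuous.mul (Continuous.mul ?_ (hT I).continuous) (hT J).continuous
  exact continuous_finsetProd _ fun s _ => (contDiff_matrix_inv hg hdet _ _).continuous

theorem contDiff_pullback {F : E4 → E4} (hF : ContDiff ℝ ∞ F)
    (hg : ∀ i j, ContDiff ℝ ∞ fun x => g x i j) (i j : Fin 4) :
    ContDiff ℝ ∞ fun x => pullback F g x i j := by
  have h (i k : Fin 4) : ContDiff ℝ ∞ fun x => (fderiv ℝ F x (basisVec i)) k :=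
    (contDiff_coord k).comp ((hF.fderiv_right (m := ∞) le_rfl).clm_apply contDiff_const)
  simp only [pullback, Matrix.of_apply]
  exact ContDiff.sum fun k _ => ContDiff.sum fun l _ =>
    (((hg k l).comp hF).mul (h i k)).mul (h j l)

end

theorem contDiff_taubNUT {m : ℝ} (hm : 0 < m) (i j : Fin 4) :
    ContDiff ℝ ∞ fun x => taubNUT m x i j := by
  have h1 := contDiff_P hm
  have h2 := contDiff_Q hm
  have h3 := contDiff_coord
  have h4 := contDiff_R hm
  have h5 : ContDiff ℝ ∞ fun x => (1 + 4 * m * R m x)⁻¹ :=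
    ContDiff.inv (by fun_prop) fun x => (one_add_pos hm x).ne'
  simp only [taubNUT_smooth_form hm, coframe_one_apply, coframe_two_apply, radialForm_apply,
    angularForm_apply]
  fun_prop

theorem isUnit_det_coMatrix {m : ℝ} (hm : 0 < m) {x : E4} (hx : x ≠ 0) :
    IsUnit (coMatrix (coframe m) x).det := by
  rw [isUnit_iff_ne_zero]
  intro h
  obtain ⟨v, hv, h0⟩ := Matrix.exists_mulVec_eq_zero_iff.2 h
  set X : E4 := WithLp.toLp 2 v
  have hX : X = ∑ i, v i • basisVec i := by
    ext j
    simp [X, basisVec, Fin.sum_univ_four]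
    fin_cases j <;> simp
  have hθ : ∀ a, coframe m a x X = 0 := by
    intro a
    have := congrFun h0 a
    rw [hX, map_sum]
    simp only [map_smul, smul_eq_mul]
    simpa [Matrix.mulVec, dotProduct, coMatrix, mul_comm] using this
  have hK := one_add_pos hm x
  have hR := R_pos hm hx
  have e0 : radialForm m x X = 0 := by
    have := hθ 0
    simpa [coframe, hK.ne'] using this
  have e3 : angularForm m x X = 0 := by
    have := hθ 3
    simpa [coframe, hR.ne'] using this
  have key := sum_forms_eq hm x X X
  rw [e0, e3, hθ 1, hθ 2] at key
  have h1 : P m x * (X 0 * X 0 + X 1 * X 1) + Q m x * (X 2 * X 2 + X 3 * X 3) = 0 := by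
    have : 2 * R m x ≠ 0 := by positivity
    refine (mul_eq_zero.1 ?_).resolve_left this
    linarith
  have hP := P_pos m x
  have hQ := Q_pos m x
  have p1 : 0 ≤ P m x * (X 0 * X 0 + X 1 * X 1) :=
    mul_nonneg hP.le (by nlinarith [mul_self_nonneg (X 0), mul_self_nonneg (X 1)])
  have p2 : 0 ≤ Q m x * (X 2 * X 2 + X 3 * X 3) :=
    mul_nonneg hQ.le (by nlinarith [mul_self_nonneg (X 2), mul_self_nonneg (X 3)])
  have q1 : X 0 * X 0 + X 1 * X 1 = 0 :=
    (mul_eq_zero.1 (le_antisymm (by linarith) p1)).resolve_left hP.ne'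
  have q2 : X 2 * X 2 + X 3 * X 3 = 0 :=
    (mul_eq_zero.1 (le_antisymm (by linarith) p2)).resolve_left hQ.ne'
  refine hv (funext fun i => ?_)
  show X i = 0
  have k := fun i => mul_self_nonneg (X i)
  have k0 := k 0
  have k1 := k 1
  have k2 := k 2
  have k3 := k 3
  refine mul_self_eq_zero.1 (le_antisymm ?_ (k i))
  fin_cases i <;> simp <;> linarith

theorem V_pos {m : ℝ} (hm : 0 < m) {x : E4} (hx : x ≠ 0) : 0 < V m x := by
  have := R_pos hm hx
  have := one_add_pos hm x
  rw [V]
  positivity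

theorem diagCoeff_pos {m : ℝ} (hm : 0 < m) {x : E4} (hx : x ≠ 0) (a : Fin 4) :
    0 < diagCoeff m a x := by
  have := V_pos hm hx
  fin_cases a <;> simpa [diagCoeff]

theorem det_taubNUT_ne_zero {m : ℝ} (hm : 0 < m) (x : E4) : (taubNUT m x).det ≠ 0 := by
  by_cases hx : x = 0
  · rw [taubNUT, if_pos hx, Matrix.det_one]
    exact one_ne_zero
  · have h1 : taubNUT m x = (coMatrix (coframe m) x).transpose
        * Matrix.diagonal (fun a => diagCoeff m a x) * coMatrix (coframe m) x := by
      ext i j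
      rw [taubNUT_apply hm hx, Matrix.mul_apply]
      refine Finset.sum_congr rfl fun a _ => ?_
      rw [Matrix.mul_diagonal]
      simp [coMatrix]
      ring
    have h2 := (isUnit_det_coMatrix hm hx).ne_zero
    rw [h1, Matrix.det_mul, Matrix.det_mul, Matrix.det_transpose, Matrix.det_diagonal]
    refine mul_ne_zero (mul_ne_zero h2 ?_) h2
    exact Finset.prod_ne_zero_iff.2 fun a _ => (diagCoeff_pos hm hx a).ne'

theorem add_norm_pow_pos {κ : ℝ} (hκ : 0 < κ) (x : E4) : 0 < κ + ‖x‖ ^ 4 := by positivity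

theorem contDiff_norm_pow_four : ContDiff ℝ ∞ fun x : E4 => ‖x‖ ^ 4 := by
  have : (fun x : E4 => ‖x‖ ^ 4) = fun x : E4 => (‖x‖ ^ 2) ^ 2 := by
    ext x
    ring
  rw [this]
  exact (contDiff_norm_sq ℝ).pow 2

theorem contDiff_beth_factor (a : ℝ) {κ : ℝ} (hκ : 0 < κ) :
    ContDiff ℝ ∞ fun x : E4 => 1 + a / (κ + ‖x‖ ^ 4) :=
  contDiff_const.add <| contDiff_const.div (contDiff_const.add contDiff_norm_pow_four)
    fun x => (add_norm_pow_pos hκ x).ne'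

theorem contDiff_beth (a : ℝ) {κ : ℝ} (hκ : 0 < κ) : ContDiff ℝ ∞ (beth a κ) :=
  (contDiff_beth_factor a hκ).smul contDiff_id

theorem norm_sq_le_of_R_le {m : ℝ} (hm : 0 < m) {ρ : ℝ} {x : E4} (hx : R m x ≤ ρ) :
    ‖x‖ ^ 2 ≤ 2 * ρ * Real.exp (4 * m * ρ) := by
  have h1 := abs_le.1 (abs_y_le hm 0 x)
  have h3 := two_mul_R hm x
  have hP : 1 ≤ P m x * Real.exp (4 * m * ρ) := by
    rw [P, ← Real.exp_add]
    exact Real.one_le_exp (by nlinarith)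
  have hQ : 1 ≤ Q m x * Real.exp (4 * m * ρ) := by
    rw [Q, ← Real.exp_add]
    exact Real.one_le_exp (by nlinarith)
  have hA : 0 ≤ x 0 ^ 2 + x 1 ^ 2 := by positivity
  have hB : 0 ≤ x 2 ^ 2 + x 3 ^ 2 := by positivity
  have he := Real.exp_pos (4 * m * ρ)
  rw [norm_sq_eq]
  calc _ ≤ (P m x * Real.exp (4 * m * ρ)) * (x 0 ^ 2 + x 1 ^ 2)
        + (Q m x * Real.exp (4 * m * ρ)) * (x 2 ^ 2 + x 3 ^ 2) :=
        add_le_add (le_mul_of_one_le_left hA hP) (le_mul_of_one_le_left hB hQ)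
    _ = 2 * R m x * Real.exp (4 * m * ρ) := by rw [h3]; ring
    _ ≤ _ := by gcongr

/-- A continuous function which is `O(R⁻¹)` for large `R` is `O(R⁻¹)`. -/
theorem exists_bound_of_continuous {m : ℝ} (hm : 0 < m) {F : E4 → ℝ} (hF : Continuous F) {ρ : ℝ}
    (h : ∃ C, ∀ x, ρ < R m x → F x ≤ C * (R m x)⁻¹) :
    ∃ C, ∀ x, x ≠ 0 → F x ≤ C * (R m x)⁻¹ := by
  obtain ⟨C₁, h₁⟩ := h
  obtain ⟨C₂, h₂⟩ := (isCompact_closedBall (0 : E4)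
    (Real.sqrt (2 * ρ * Real.exp (4 * m * ρ)))).exists_bound_of_continuousOn hF.continuousOn
  refine ⟨max C₁ (C₂ * ρ), fun x hx => ?_⟩
  have hR := R_pos hm hx
  rcases lt_or_ge ρ (R m x) with hx' | hx'
  · exact (h₁ x hx').trans (by gcongr; exact le_max_left _ _)
  · have hb := h₂ x (by
      rw [mem_closedBall_zero_iff]
      exact Real.le_sqrt_of_sq_le (norm_sq_le_of_R_le hm hx'))
    have hC₂ : 0 ≤ C₂ := (norm_nonneg _).trans hb
    calc F x ≤ C₂ := (le_abs_self _).trans hb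
      _ ≤ C₂ * ρ * (R m x)⁻¹ := by
          rw [← div_eq_mul_inv, le_div_iff₀ hR]
          gcongr
      _ ≤ _ := by gcongr; exact le_max_right _ _

/-! ### The exterior derivatives of the coframe -/

theorem contDiff_y {m : ℝ} (hm : 0 < m) (i : Fin 3) : ContDiff ℝ ∞ (y m i) := by
  have h := contDiff_coord
  fin_cases i
  · exact contDiff_y_zero hm
  · show ContDiff ℝ ∞ (y m 1)
    rw [show y m 1 = fun x => x 0 * x 3 + x 1 * x 2 from funext (y_one m)]
    fun_prop
  · show ContDiff ℝ ∞ (y m 2)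
    rw [show y m 2 = fun x => x 1 * x 3 - x 0 * x 2 from funext (y_two m)]
    fun_prop

theorem hasFDerivAt_P {m : ℝ} (hm : 0 < m) (x : E4) :
    HasFDerivAt (P m) ((-(4 * m * P m x)) • coframe m 0 x) x := by
  have h : HasFDerivAt (fun x => -(4 * m * y m 0 x)) (-((4 * m) • coframe m 0 x)) x :=
    ((hasFDerivAt_y_zero hm x).const_mul (4 * m)).neg
  refine h.exp.congr_fderiv ?_
  refine ContinuousLinearMap.ext fun X => ?_
  simp [P]
  ring

theorem hasFDerivAt_Q {m : ℝ} (hm : 0 < m) (x : E4) :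
    HasFDerivAt (Q m) ((4 * m * Q m x) • coframe m 0 x) x := by
  have h : HasFDerivAt (fun x => 4 * m * y m 0 x) ((4 * m) • coframe m 0 x) x :=
    (hasFDerivAt_y_zero hm x).const_mul (4 * m)
  refine h.exp.congr_fderiv ?_
  rw [smul_smul, Q]
  congr 1
  ring

theorem hasFDerivAt_R {m : ℝ} (hm : 0 < m) (x : E4) :
    HasFDerivAt (R m) (-(4 * m * y m 0 x) • coframe m 0 x
      + (P m x • (x 0 • dx 0 + x 1 • dx 1) + Q m x • (x 2 • dx 2 + x 3 • dx 3))) x := by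
  have c := fun i => hasFDerivAt_coord i x
  have h := (((hasFDerivAt_P hm x).mul (((c 0).pow 2).add ((c 1).pow 2))).add
    ((hasFDerivAt_Q hm x).mul (((c 2).pow 2).add ((c 3).pow 2)))).const_mul (1 / 2)
  refine (h.congr_of_eventuallyEq (Filter.Eventually.of_forall fun z => ?_)).congr_fderiv ?_
  · have := two_mul_R hm z
    show R m z = 1 / 2 * (P m z * (z 0 ^ 2 + z 1 ^ 2) + Q m z * (z 2 ^ 2 + z 3 ^ 2))
    linarith
  · refine ContinuousLinearMap.ext fun X => ?_
    have := two_mul_y_zero hm x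
    simp
    linear_combination (2 * m * coframe m 0 x X) * this

theorem hasFDerivAt_angularForm {m : ℝ} (hm : 0 < m) (x X : E4) :
    HasFDerivAt (fun z => angularForm m z X)
      (-(4 * m * (P m x * (x 0 * X 1 - x 1 * X 0) + Q m x * (x 2 * X 3 - x 3 * X 2)))
          • coframe m 0 x
        + (P m x • (X 1 • dx 0 - X 0 • dx 1) - Q m x • (X 3 • dx 2 - X 2 • dx 3))) x := by
  have c := fun i => hasFDerivAt_coord i x
  have h := ((hasFDerivAt_P hm x).mul (((c 0).mul_const (X 1)).sub ((c 1).mul_const (X 0)))).sub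
    ((hasFDerivAt_Q hm x).mul (((c 2).mul_const (X 3)).sub ((c 3).mul_const (X 2))))
  refine (h.congr_of_eventuallyEq (Filter.Eventually.of_forall fun z => ?_)).congr_fderiv ?_
  · exact angularForm_apply m z X
  · refine ContinuousLinearMap.ext fun Y => ?_
    simp
    ring

theorem hasFDerivAt_coframe_three {m : ℝ} (hm : 0 < m) {x : E4} (hx : x ≠ 0) (X : E4) :
    HasFDerivAt (fun z => coframe m 3 z X)
      ((2 * R m x)⁻¹ • fderiv ℝ (fun z => angularForm m z X) x
        - (2 * R m x ^ 2)⁻¹ • angularForm m x X • fderiv ℝ (R m) x) x := by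
  have hR := R_pos hm hx
  have h1 : HasFDerivAt (fun z => 2 * R m z) ((2 : ℝ) • fderiv ℝ (R m) x) x :=
    (hasFDerivAt_R hm x).differentiableAt.hasFDerivAt.const_mul 2
  have h2 := (hasFDerivAt_inv (show 2 * R m x ≠ 0 by positivity)).comp x h1
  have h := h2.mul (hasFDerivAt_angularForm hm x X).differentiableAt.hasFDerivAt
  refine (h.congr_of_eventuallyEq (Filter.Eventually.of_forall fun z => rfl)).congr_fderiv ?_
  refine ContinuousLinearMap.ext fun Y => ?_
  simp
  field_simp
  ring

/-- `dη = -(2R³)⁻¹ (y₁ dy₂∧dy₃ + y₂ dy₃∧dy₁ + y₃ dy₁∧dy₂)`. -/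
theorem extDeriv_coframe_three {m : ℝ} (hm : 0 < m) {x : E4} (hx : x ≠ 0) (X Y : E4) :
    fderiv ℝ (fun z => coframe m 3 z Y) x X - fderiv ℝ (fun z => coframe m 3 z X) x Y
      = -(2 * R m x ^ 3)⁻¹ *
        (y m 0 x * (coframe m 1 x X * coframe m 2 x Y - coframe m 1 x Y * coframe m 2 x X)
        + y m 1 x * (coframe m 2 x X * coframe m 0 x Y - coframe m 2 x Y * coframe m 0 x X)
        + y m 2 x * (coframe m 0 x X * coframe m 1 x Y - coframe m 0 x Y * coframe m 1 x X)) := by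
  have hR := R_pos hm hx
  have hK := one_add_pos hm x
  have hdx : ∀ i Z, dx i Z = Z i := fun _ _ => rfl
  rw [(hasFDerivAt_coframe_three hm hx X).fderiv, (hasFDerivAt_coframe_three hm hx Y).fderiv,
    (hasFDerivAt_R hm x).fderiv, (hasFDerivAt_angularForm hm x X).fderiv,
    (hasFDerivAt_angularForm hm x Y).fderiv, y_one, y_two]
  simp only [sub_apply, add_apply, smul_apply, smul_eq_mul, angularForm_apply,
    coframe_one_apply, coframe_two_apply, hdx]
  -- `K dy₁` is the radial form, and `R S - y₁ N = U` in the notation below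
  have hr : ∀ Z, (1 + 4 * m * R m x) * coframe m 0 x Z
      = P m x * (x 0 * Z 0 + x 1 * Z 1) - Q m x * (x 2 * Z 2 + x 3 * Z 3) := by
    intro Z
    rw [coframe_zero_apply]
    field_simp
  have hU : ∀ Z : E4, R m x * (P m x * (x 0 * Z 1 - x 1 * Z 0) + Q m x * (x 2 * Z 3 - x 3 * Z 2))
      - y m 0 x * (P m x * (x 0 * Z 1 - x 1 * Z 0) - Q m x * (x 2 * Z 3 - x 3 * Z 2))
      = (x 2 ^ 2 + x 3 ^ 2) * (x 0 * Z 1 - x 1 * Z 0)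
        + (x 0 ^ 2 + x 1 ^ 2) * (x 2 * Z 3 - x 3 * Z 2) := by
    intro Z
    have h1 := two_mul_R hm x
    have h2 := two_mul_y_zero hm x
    have h3 := P_mul_Q m x
    linear_combination (1 / 2) * (P m x * (x 0 * Z 1 - x 1 * Z 0)
        + Q m x * (x 2 * Z 3 - x 3 * Z 2)) * h1
      - (1 / 2) * (P m x * (x 0 * Z 1 - x 1 * Z 0) - Q m x * (x 2 * Z 3 - x 3 * Z 2)) * h2
      + ((x 2 ^ 2 + x 3 ^ 2) * (x 0 * Z 1 - x 1 * Z 0)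
        + (x 0 ^ 2 + x 1 ^ 2) * (x 2 * Z 3 - x 3 * Z 2)) * h3
  have hrX := hr X
  have hrY := hr Y
  have hUX := hU X
  have hUY := hU Y
  have hR2 := two_mul_R hm x
  have hy2 := two_mul_y_zero hm x
  have hPQ := P_mul_Q m x
  generalize coframe m 0 x X = p at *
  generalize coframe m 0 x Y = q at *
  generalize y m 0 x = t at *
  generalize R m x = ρ at *
  generalize P m x = P at *
  generalize Q m x = Q at *
  have final : -2 * ((P * (x 0 * X 0 + x 1 * X 1) - Q * (x 2 * X 2 + x 3 * X 3))
        * ((x 2 ^ 2 + x 3 ^ 2) * (x 0 * Y 1 - x 1 * Y 0)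
          + (x 0 ^ 2 + x 1 ^ 2) * (x 2 * Y 3 - x 3 * Y 2))
      - (P * (x 0 * Y 0 + x 1 * Y 1) - Q * (x 2 * Y 2 + x 3 * Y 3))
        * ((x 2 ^ 2 + x 3 ^ 2) * (x 0 * X 1 - x 1 * X 0)
          + (x 0 ^ 2 + x 1 ^ 2) * (x 2 * X 3 - x 3 * X 2)))
      + 4 * ρ ^ 2 * (P * (X 0 * Y 1 - X 1 * Y 0) - Q * (X 2 * Y 3 - X 3 * Y 2))
      - 2 * ρ * ((P * (x 0 * X 0 + x 1 * X 1) + Q * (x 2 * X 2 + x 3 * X 3))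
          * (P * (x 0 * Y 1 - x 1 * Y 0) - Q * (x 2 * Y 3 - x 3 * Y 2))
        - (P * (x 0 * Y 0 + x 1 * Y 1) + Q * (x 2 * Y 2 + x 3 * Y 3))
          * (P * (x 0 * X 1 - x 1 * X 0) - Q * (x 2 * X 3 - x 3 * X 2)))
      + 2 * t * ((x 0 * X 3 + x 3 * X 0 + (x 1 * X 2 + x 2 * X 1))
          * (x 1 * Y 3 + x 3 * Y 1 - (x 0 * Y 2 + x 2 * Y 0))
        - (x 0 * Y 3 + x 3 * Y 0 + (x 1 * Y 2 + x 2 * Y 1))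
          * (x 1 * X 3 + x 3 * X 1 - (x 0 * X 2 + x 2 * X 0))) = 0 := by
    rw [show 4 * ρ ^ 2 = (2 * ρ) ^ 2 by ring, hR2, hy2]
    linear_combination (P * (x 0 ^ 2 + x 1 ^ 2) + Q * (x 2 ^ 2 + x 3 ^ 2)) *
      ((x 2 ^ 2 + x 3 ^ 2) * (X 0 * Y 1 - X 1 * Y 0) - (x 0 ^ 2 + x 1 ^ 2) * (X 2 * Y 3 - X 3 * Y 2)
      + ((x 0 * X 0 + x 1 * X 1) * (x 2 * Y 3 - x 3 * Y 2)
        - (x 0 * Y 0 + x 1 * Y 1) * (x 2 * X 3 - x 3 * X 2))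
      - ((x 2 * X 2 + x 3 * X 3) * (x 0 * Y 1 - x 1 * Y 0)
        - (x 2 * Y 2 + x 3 * Y 3) * (x 0 * X 1 - x 1 * X 0))) * hPQ
  have E : ρ ^ 2 * (-4 * m * (p * (P * (x 0 * Y 1 - x 1 * Y 0) + Q * (x 2 * Y 3 - x 3 * Y 2))
        - q * (P * (x 0 * X 1 - x 1 * X 0) + Q * (x 2 * X 3 - x 3 * X 2)))
        + 2 * (P * (X 0 * Y 1 - X 1 * Y 0) - Q * (X 2 * Y 3 - X 3 * Y 2)))
      - ρ * ((-(4 * m * t) * p + (P * (x 0 * X 0 + x 1 * X 1) + Q * (x 2 * X 2 + x 3 * X 3)))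
          * (P * (x 0 * Y 1 - x 1 * Y 0) - Q * (x 2 * Y 3 - x 3 * Y 2))
        - (-(4 * m * t) * q + (P * (x 0 * Y 0 + x 1 * Y 1) + Q * (x 2 * Y 2 + x 3 * Y 3)))
          * (P * (x 0 * X 1 - x 1 * X 0) - Q * (x 2 * X 3 - x 3 * X 2)))
      + t * ((x 0 * X 3 + x 3 * X 0 + (x 1 * X 2 + x 2 * X 1))
          * (x 1 * Y 3 + x 3 * Y 1 - (x 0 * Y 2 + x 2 * Y 0))
        - (x 0 * Y 3 + x 3 * Y 0 + (x 1 * Y 2 + x 2 * Y 1))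
          * (x 1 * X 3 + x 3 * X 1 - (x 0 * X 2 + x 2 * X 0)))
      - (p * ((x 2 ^ 2 + x 3 ^ 2) * (x 0 * Y 1 - x 1 * Y 0)
          + (x 0 ^ 2 + x 1 ^ 2) * (x 2 * Y 3 - x 3 * Y 2))
        - q * ((x 2 ^ 2 + x 3 ^ 2) * (x 0 * X 1 - x 1 * X 0)
          + (x 0 ^ 2 + x 1 ^ 2) * (x 2 * X 3 - x 3 * X 2))) = 0 := by
    linear_combination (1 / 2) * final - 4 * m * ρ * (p * hUY - q * hUX)
      - ((x 2 ^ 2 + x 3 ^ 2) * (x 0 * Y 1 - x 1 * Y 0)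
          + (x 0 ^ 2 + x 1 ^ 2) * (x 2 * Y 3 - x 3 * Y 2)) * hrX
      + ((x 2 ^ 2 + x 3 ^ 2) * (x 0 * X 1 - x 1 * X 0)
          + (x 0 ^ 2 + x 1 ^ 2) * (x 2 * X 3 - x 3 * X 2)) * hrY
  field_simp
  linear_combination E

theorem hasFDerivAt_coframe_castSucc {m : ℝ} (hm : 0 < m) (i : Fin 3) (x X : E4) :
    HasFDerivAt (fun z => coframe m i.castSucc z X)
      ((ContinuousLinearMap.apply ℝ ℝ X).comp (fderiv ℝ (fderiv ℝ (y m i)) x)) x := by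
  have h1 : (fun z => coframe m i.castSucc z X) = fun z => fderiv ℝ (y m i) z X := by
    ext z
    rw [(hasFDerivAt_y hm i z).fderiv]
  rw [h1]
  have h2 : DifferentiableAt ℝ (fderiv ℝ (y m i)) x :=
    ((contDiff_y hm i).fderiv_right (m := ∞) le_rfl).differentiable (by simp) x
  exact (ContinuousLinearMap.apply ℝ ℝ X).hasFDerivAt.comp x h2.hasFDerivAt

theorem extDeriv_coframe_castSucc {m : ℝ} (hm : 0 < m) (i : Fin 3) (x X Y : E4) :
    fderiv ℝ (fun z => coframe m i.castSucc z Y) x X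
      - fderiv ℝ (fun z => coframe m i.castSucc z X) x Y = 0 := by
  rw [(hasFDerivAt_coframe_castSucc hm i x X).fderiv, (hasFDerivAt_coframe_castSucc hm i x Y).fderiv]
  have h := ((contDiff_y hm i).contDiffAt (x := x)).isSymmSndFDerivAt
    (by rw [minSmoothness_of_isRCLikeNormedField]; exact WithTop.coe_le_coe.2 le_top) X Y
  simp [h]

theorem differentiableAt_coframe {m : ℝ} (hm : 0 < m) {x : E4} (hx : x ≠ 0) (a : Fin 4) (X : E4) :
    DifferentiableAt ℝ (fun z => coframe m a z X) x := by
  induction a using Fin.lastCases with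
  | last => exact (hasFDerivAt_coframe_three hm hx X).differentiableAt
  | cast i => exact (hasFDerivAt_coframe_castSucc hm i x X).differentiableAt

/-- The components of `y₁ dy₂∧dy₃ + y₂ dy₃∧dy₁ + y₃ dy₁∧dy₂` in the coframe. -/
def areaCoeff (m : ℝ) : Fin 4 → Fin 4 → E4 → ℝ :=
  ![![0, y m 2, -y m 1, 0], ![-y m 2, 0, y m 0, 0], ![y m 1, -y m 0, 0, 0], ![0, 0, 0, 0]]

/-- The components of the exterior derivatives of the coframe. -/
def torsionCoeff (m : ℝ) (c a b : Fin 4) (x : E4) : ℝ :=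
  if c = 3 then -(2 * R m x ^ 3)⁻¹ * areaCoeff m a b x else 0

theorem extDeriv_coframe {m : ℝ} (hm : 0 < m) {x : E4} (hx : x ≠ 0) (c i j : Fin 4) :
    pderiv i (fun z => coframe m c z (basisVec j)) x
      - pderiv j (fun z => coframe m c z (basisVec i)) x
      = ∑ a, ∑ b, torsionCoeff m c a b x *
        (coframe m a x (basisVec i) * coframe m b x (basisVec j)) := by
  simp only [pderiv]
  induction c using Fin.lastCases with
  | last =>
    have h := extDeriv_coframe_three hm hx (basisVec i) (basisVec j)
    rw [show (Fin.last 3) = 3 from rfl, h]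
    simp only [torsionCoeff, if_true, areaCoeff, Fin.sum_univ_four]
    simp
    ring
  | cast k =>
    rw [extDeriv_coframe_castSucc hm]
    have : k.castSucc ≠ 3 := (Fin.castSucc_lt_last k).ne
    simp [torsionCoeff, this]

/-! ### Functions bounded with their derivatives along a coframe -/

/-- The function `F` and its derivatives of order at most `n` along the coframe `θ` are `O(w)`
on `Ω`. -/
def Sym (θ : Fin 4 → E4 → (E4 →L[ℝ] ℝ)) (Ω : Set E4) (w : E4 → ℝ) : ℕ → (E4 → ℝ) → Prop
  | 0, F => ∃ C, ∀ x ∈ Ω, |F x| ≤ C * w x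
  | n + 1, F => (∃ C, ∀ x ∈ Ω, |F x| ≤ C * w x) ∧ ∃ F' : Fin 4 → E4 → ℝ,
      (∀ x ∈ Ω, HasFDerivAt F (∑ a, F' a x • θ a x) x) ∧ ∀ a, Sym θ Ω w n (F' a)

namespace Sym

variable {θ : Fin 4 → E4 → (E4 →L[ℝ] ℝ)} {Ω : Set E4} {w w' : E4 → ℝ} {n : ℕ} {F G : E4 → ℝ}

theorem bound (h : Sym θ Ω w n F) : ∃ C, ∀ x ∈ Ω, |F x| ≤ C * w x := by
  cases n with
  | zero => exact h
  | succ n => exact h.1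

theorem of_succ (h : Sym θ Ω w (n + 1) F) : Sym θ Ω w n F := by
  induction n generalizing F with
  | zero => exact h.1
  | succ n ih => exact ⟨h.1, h.2.choose, h.2.choose_spec.1, fun a => ih (h.2.choose_spec.2 a)⟩

theorem weight_mono (hw : ∀ x ∈ Ω, 0 ≤ w x) (K : ℝ) (hK : ∀ x ∈ Ω, w x ≤ K * w' x)
    (h : Sym θ Ω w n F) : Sym θ Ω w' n F := by
  have key : ∀ {G : E4 → ℝ}, (∃ C, ∀ x ∈ Ω, |G x| ≤ C * w x) → ∃ C, ∀ x ∈ Ω, |G x| ≤ C * w' x := by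
    rintro G ⟨C, hC⟩
    refine ⟨|C| * K, fun x hx => (hC x hx).trans ?_⟩
    calc C * w x ≤ |C| * w x := mul_le_mul_of_nonneg_right (le_abs_self C) (hw x hx)
      _ ≤ |C| * (K * w' x) := mul_le_mul_of_nonneg_left (hK x hx) (abs_nonneg C)
      _ = _ := by ring
  induction n generalizing F with
  | zero => exact key h
  | succ n ih =>
    obtain ⟨h1, F', h2, h3⟩ := h
    exact ⟨key h1, F', h2, fun a => ih (h3 a)⟩

theorem congr (hΩ : IsOpen Ω) (h : Sym θ Ω w n F) (hFG : ∀ x ∈ Ω, G x = F x) : Sym θ Ω w n G := by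
  cases n with
  | zero =>
    obtain ⟨C, hC⟩ := h
    exact ⟨C, fun x hx => by rw [hFG x hx]; exact hC x hx⟩
  | succ n =>
    obtain ⟨⟨C, hC⟩, F', h2, h3⟩ := h
    refine ⟨⟨C, fun x hx => by rw [hFG x hx]; exact hC x hx⟩, F', fun x hx => ?_, h3⟩
    refine (h2 x hx).congr_of_eventuallyEq ?_
    filter_upwards [hΩ.mem_nhds hx] with z hz using hFG z hz

theorem zero : Sym θ Ω w n fun _ => 0 := by
  induction n with
  | zero => exact ⟨0, fun x _ => by simp⟩
  | succ n ih => exact ⟨⟨0, fun x _ => by simp⟩, fun _ _ => 0,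
      fun x _ => (hasFDerivAt_const _ _).congr_fderiv (by simp), fun _ => ih⟩

theorem const (c : ℝ) : Sym θ Ω (fun _ => 1) n fun _ => c := by
  cases n with
  | zero => exact ⟨|c|, fun x _ => by simp⟩
  | succ n => exact ⟨⟨|c|, fun x _ => by simp⟩, fun _ _ => 0,
      fun x _ => (hasFDerivAt_const _ _).congr_fderiv (by simp), fun _ => zero⟩

theorem add (hF : Sym θ Ω w n F) (hG : Sym θ Ω w n G) : Sym θ Ω w n fun x => F x + G x := by
  have key : ∀ {F G : E4 → ℝ}, (∃ C, ∀ x ∈ Ω, |F x| ≤ C * w x) →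
      (∃ C, ∀ x ∈ Ω, |G x| ≤ C * w x) → ∃ C, ∀ x ∈ Ω, |F x + G x| ≤ C * w x := by
    rintro F G ⟨C, hC⟩ ⟨C', hC'⟩
    refine ⟨C + C', fun x hx => (abs_add_le _ _).trans ?_⟩
    rw [add_mul]
    exact add_le_add (hC x hx) (hC' x hx)
  induction n generalizing F G with
  | zero => exact key hF hG
  | succ n ih =>
    obtain ⟨h1, F', h2, h3⟩ := hF
    obtain ⟨k1, G', k2, k3⟩ := hG
    refine ⟨key h1 k1, fun a x => F' a x + G' a x, fun x hx => ?_, fun a => ih (h3 a) (k3 a)⟩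
    refine ((h2 x hx).add (k2 x hx)).congr_fderiv ?_
    simp only [add_smul, Finset.sum_add_distrib]

theorem mul (hF : Sym θ Ω w n F) (hG : Sym θ Ω w' n G) :
    Sym θ Ω (fun x => w x * w' x) n fun x => F x * G x := by
  have key : ∀ {F G : E4 → ℝ}, (∃ C, ∀ x ∈ Ω, |F x| ≤ C * w x) →
      (∃ C, ∀ x ∈ Ω, |G x| ≤ C * w' x) → ∃ C, ∀ x ∈ Ω, |F x * G x| ≤ C * (w x * w' x) := by
    rintro F G ⟨C, hC⟩ ⟨C', hC'⟩
    refine ⟨C * C', fun x hx => ?_⟩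
    rw [abs_mul]
    calc |F x| * |G x| ≤ (C * w x) * (C' * w' x) :=
          mul_le_mul (hC x hx) (hC' x hx) (abs_nonneg _) ((abs_nonneg _).trans (hC x hx))
      _ = _ := by ring
  induction n generalizing F G with
  | zero => exact key hF hG
  | succ n ih =>
    have hF0 := hF.of_succ
    have hG0 := hG.of_succ
    obtain ⟨h1, F', h2, h3⟩ := hF
    obtain ⟨k1, G', k2, k3⟩ := hG
    refine ⟨key h1 k1, fun a x => F x * G' a x + F' a x * G x, fun x hx => ?_,
      fun a => (ih hF0 (k3 a)).add (ih (h3 a) hG0)⟩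
    refine ((h2 x hx).mul (k2 x hx)).congr_fderiv ?_
    simp only [add_smul, Finset.sum_add_distrib, Finset.smul_sum, smul_smul, mul_comm]

theorem const_mul (c : ℝ) (hF : Sym θ Ω w n F) : Sym θ Ω w n fun x => c * F x := by
  simpa using (const (θ := θ) (Ω := Ω) (n := n) c).mul hF

theorem neg (hF : Sym θ Ω w n F) : Sym θ Ω w n fun x => -F x := by
  simpa using hF.const_mul (-1)

theorem sub (hF : Sym θ Ω w n F) (hG : Sym θ Ω w n G) : Sym θ Ω w n fun x => F x - G x := by
  simpa [sub_eq_add_neg] using hF.add hG.neg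

theorem sum {ι : Type*} {F : ι → E4 → ℝ} (s : Finset ι) (hF : ∀ i ∈ s, Sym θ Ω w n (F i)) :
    Sym θ Ω w n fun x => ∑ i ∈ s, F i x := by
  classical
  induction s using Finset.induction_on with
  | empty => simpa using zero
  | insert i s hi ih =>
    simp only [Finset.sum_insert hi]
    exact (hF i (Finset.mem_insert_self i s)).add
      (ih fun j hj => hF j (Finset.mem_insert_of_mem hj))

theorem inv {c : ℝ} (hc : 0 < c) (hw : ∀ x ∈ Ω, 0 < w x) (hcF : ∀ x ∈ Ω, c * w x ≤ |F x|)
    (hF : Sym θ Ω w n F) : Sym θ Ω (fun x => (w x)⁻¹) n fun x => (F x)⁻¹ := by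
  have key : ∃ C, ∀ x ∈ Ω, |(F x)⁻¹| ≤ C * (w x)⁻¹ := by
    refine ⟨c⁻¹, fun x hx => ?_⟩
    rw [abs_inv, ← mul_inv]
    exact inv_anti₀ (mul_pos hc (hw x hx)) (hcF x hx)
  induction n with
  | zero => exact key
  | succ n ih =>
    have h0 := ih hF.of_succ
    obtain ⟨h1, F', h2, h3⟩ := hF
    refine ⟨key, fun a x => -((F x)⁻¹ * (F x)⁻¹ * F' a x), fun x hx => ?_, fun a => ?_⟩
    · have hne : F x ≠ 0 := abs_pos.1 ((mul_pos hc (hw x hx)).trans_le (hcF x hx))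
      refine ((hasDerivAt_inv hne).comp_hasFDerivAt x (h2 x hx)).congr_fderiv ?_
      rw [Finset.smul_sum]
      refine Finset.sum_congr rfl fun a _ => ?_
      rw [smul_smul]
      congr 1
      field_simp
    · refine (((h0.mul h0).mul (h3 a)).neg).weight_mono (fun x hx => ?_) 1 fun x hx => ?_
      · have := hw x hx
        positivity
      · have := hw x hx
        field_simp
        exact le_rfl

theorem exp (hF : Sym θ Ω (fun _ => 1) n F) : Sym θ Ω (fun _ => 1) n fun x => Real.exp (F x) := by
  have key : ∃ C, ∀ x ∈ Ω, |Real.exp (F x)| ≤ C * 1 := by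
    obtain ⟨C, hC⟩ := hF.bound
    refine ⟨Real.exp C, fun x hx => ?_⟩
    rw [Real.abs_exp, mul_one, Real.exp_le_exp]
    exact (le_abs_self _).trans (by simpa using hC x hx)
  induction n with
  | zero => exact key
  | succ n ih =>
    have h0 := ih hF.of_succ
    obtain ⟨h1, F', h2, h3⟩ := hF
    refine ⟨key, fun a x => Real.exp (F x) * F' a x, fun x hx => ?_, fun a => ?_⟩
    · refine ((h2 x hx).exp).congr_fderiv ?_
      simp only [Finset.smul_sum, smul_smul]
    · simpa using h0.mul (h3 a)

end Sym

/-- Covariant differentiation of a tensor whose components are `O(w)` with their derivatives. -/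
theorem exists_comps_covDeriv {g : BilinField} {θ : Fin 4 → E4 → (E4 →L[ℝ] ℝ)} {Ω : Set E4}
    {w : E4 → ℝ} {γ : Fin 4 → Fin 4 → Fin 4 → E4 → ℝ} (hΩ : IsOpen Ω)
    (hθ : ∀ x ∈ Ω, ∀ a i, DifferentiableAt ℝ (fun z => θ a z (basisVec i)) x)
    (hγ : ∀ x ∈ Ω, ∀ c i j, ∑ k, christoffel g x k i j * θ c x (basisVec k)
      = pderiv i (fun z => θ c z (basisVec j)) x
        + ∑ a, ∑ b, γ c a b x * (θ a x (basisVec i) * θ b x (basisVec j)))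
    {n : ℕ} (hγn : ∀ c a b, Sym θ Ω (fun _ => 1) n (γ c a b))
    {k : ℕ} {T : TensorField k}
    (hT : ∃ t, HasComps θ Ω T t ∧ ∀ A, Sym θ Ω w (n + 1) (t A)) :
    ∃ t, HasComps θ Ω (covDeriv g T) t ∧ ∀ A, Sym θ Ω w n (t A) := by
  obtain ⟨t, h1, h2⟩ := hT
  choose t' h3 h4 using fun A => (h2 A).2
  refine ⟨_, h1.covDeriv hΩ hθ hγ (t' := t') fun x hx A => h3 A x hx, fun A => ?_⟩
  refine (h4 _ _).sub (Sym.sum _ fun s _ => Sym.sum _ fun c _ => ?_)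
  simpa using (hγn _ _ _).mul (h2 _).of_succ

theorem exists_tensorNorm_le {g : BilinField} {θ : Fin 4 → E4 → (E4 →L[ℝ] ℝ)} {Ω : Set E4}
    {d : Fin 4 → E4 → ℝ} {w : E4 → ℝ}
    (hg : ∀ x ∈ Ω, ∀ i j, g x i j = ∑ a, d a x * (θ a x (basisVec i) * θ a x (basisVec j)))
    (hd : ∀ x ∈ Ω, ∀ a, 0 < d a x) (hu : ∀ x ∈ Ω, IsUnit (coMatrix θ x).det)
    {M : ℝ} (hM : ∀ x ∈ Ω, ∀ a, (d a x)⁻¹ ≤ M) {k : ℕ} {T : TensorField k}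
    (hT : ∃ t, HasComps θ Ω T t ∧ ∀ A, Sym θ Ω w 0 (t A)) :
    ∃ C, ∀ x ∈ Ω, tensorNorm g T x ≤ C * w x := by
  obtain ⟨t, h1, h2⟩ := hT
  choose C hC using h2
  refine ⟨∑ A, Real.sqrt (M ^ k) * C A, fun x hx => ?_⟩
  rw [tensorNorm_eq h1 hx (hg x hx) (fun a => (hd x hx a).ne') (hu x hx), Finset.sum_mul]
  have hnn : ∀ A : Fin k → Fin 4, 0 ≤ Real.sqrt (M ^ k) * C A * w x := fun A => by
    rw [mul_assoc]
    exact mul_nonneg (Real.sqrt_nonneg _) ((abs_nonneg _).trans (hC A x hx))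
  refine Real.sqrt_le_iff.2 ⟨Finset.sum_nonneg fun A _ => hnn A, ?_⟩
  calc ∑ A, (∏ s, (d (A s) x)⁻¹) * t A x ^ 2
      ≤ ∑ A, (Real.sqrt (M ^ k) * C A * w x) ^ 2 := by
        refine Finset.sum_le_sum fun A _ => ?_
        have hprod : ∏ s, (d (A s) x)⁻¹ ≤ M ^ k := by
          calc _ ≤ ∏ _s : Fin k, M := Finset.prod_le_prod
                (fun s _ => inv_nonneg.2 (hd x hx _).le) fun s _ => hM x hx _
            _ = M ^ k := by simp
        have hM0 : 0 ≤ M ^ k :=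
          (Finset.prod_nonneg fun s _ => inv_nonneg.2 (hd x hx (A s)).le).trans hprod
        rw [mul_assoc, mul_pow, Real.sq_sqrt hM0]
        refine mul_le_mul hprod ?_ (sq_nonneg _) hM0
        rw [← sq_abs]
        exact pow_le_pow_left₀ (abs_nonneg _) (hC A x hx) 2
    _ ≤ _ := Finset.sum_sq_le_sq_sum_of_nonneg fun A _ => hnn A

/-! ### The geometry of the Taub-NUT metric for large `R` -/

/-- The region `R > ρ`. -/
def region (m ρ : ℝ) : Set E4 := {x | ρ < R m x}

theorem isOpen_region {m : ℝ} (hm : 0 < m) (ρ : ℝ) : IsOpen (region m ρ) :=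
  isOpen_lt continuous_const (contDiff_R hm).continuous

theorem R_zero {m : ℝ} (hm : 0 < m) : R m 0 = 0 := by
  have := two_mul_R hm 0
  simpa using this

theorem ne_zero_of_R_pos {m : ℝ} (hm : 0 < m) {x : E4} (hx : 0 < R m x) : x ≠ 0 := by
  rintro rfl
  rw [R_zero hm] at hx
  exact lt_irrefl _ hx

/-- The function `F` and its derivatives of order at most `n` along the coframe are `O(Rᵏ)`
for `R > ρ`. -/
abbrev SymR (m ρ : ℝ) (k : ℤ) (n : ℕ) (F : E4 → ℝ) : Prop :=
  Sym (coframe m) (region m ρ) (fun x => R m x ^ k) n F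

section

variable {m ρ : ℝ} {k l j : ℤ} {n : ℕ} {F G : E4 → ℝ}

theorem symR_zero_iff : SymR m ρ 0 n F ↔ Sym (coframe m) (region m ρ) (fun _ => 1) n F := by
  simp only [SymR, zpow_zero]

theorem SymR.mono (hρ : 1 ≤ ρ) (hF : SymR m ρ k n F) (hkl : k ≤ l) : SymR m ρ l n F := by
  refine hF.weight_mono (fun x hx => ?_) 1 fun x hx => ?_
  · have hR : ρ < R m x := hx
    exact zpow_nonneg (by linarith) _
  · have hR : ρ < R m x := hx
    rw [one_mul]
    exact zpow_le_zpow_right₀ (by linarith) hkl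

theorem SymR.mul (hρ : 1 ≤ ρ) (hF : SymR m ρ k n F) (hG : SymR m ρ l n G) (hkl : k + l ≤ j) :
    SymR m ρ j n fun x => F x * G x := by
  refine SymR.mono hρ (k := k + l) ?_ hkl
  refine (Sym.mul hF hG).weight_mono (fun x hx => ?_) 1 fun x hx => ?_
  · have hR : ρ < R m x := hx
    exact mul_nonneg (zpow_nonneg (by linarith) _) (zpow_nonneg (by linarith) _)
  · have hR : ρ < R m x := hx
    rw [one_mul, zpow_add₀ (by linarith)]

theorem SymR.const (c : ℝ) : SymR m ρ 0 n fun _ => c := symR_zero_iff.2 (Sym.const c)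

theorem SymR.inv (hρ : 1 ≤ ρ) {c : ℝ} (hc : 0 < c) (hcF : ∀ x ∈ region m ρ, c * R m x ^ k ≤ F x)
    (hF : SymR m ρ k n F) : SymR m ρ (-k) n fun x => (F x)⁻¹ := by
  have h := Sym.inv (Ω := region m ρ) hc (fun x (hx : ρ < R m x) => zpow_pos (by linarith) _)
    (fun x hx => (hcF x hx).trans (le_abs_self _)) hF
  simpa only [SymR, zpow_neg] using h

theorem symR_y (hm : 0 < m) (hρ : 1 ≤ ρ) (i : Fin 3) : SymR m ρ 1 n (y m i) := by
  have key : ∃ C, ∀ x ∈ region m ρ, |y m i x| ≤ C * R m x ^ (1 : ℤ) :=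
    ⟨1, fun x _ => by simpa using abs_y_le hm i x⟩
  cases n with
  | zero => exact key
  | succ n =>
    refine ⟨key, fun a _ => if a = i.castSucc then 1 else 0, fun x _ => ?_, fun a => ?_⟩
    · simpa using hasFDerivAt_y hm i x
    · exact SymR.mono hρ (SymR.const _) (by norm_num)

/-- The components of `dR` in the coframe. -/
def gradR (m : ℝ) : Fin 4 → E4 → ℝ :=
  ![fun x => y m 0 x * (R m x)⁻¹, fun x => y m 1 x * (R m x)⁻¹, fun x => y m 2 x * (R m x)⁻¹,
    fun _ => 0]

theorem hasFDerivAt_R_gradR (hm : 0 < m) {x : E4} (hx : x ≠ 0) :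
    HasFDerivAt (R m) (∑ a, gradR m a x • coframe m a x) x := by
  have hL := (hasFDerivAt_R hm x).differentiableAt.hasFDerivAt
  have h1 := (((hasFDerivAt_y hm 0 x).pow 2).add ((hasFDerivAt_y hm 1 x).pow 2)).add
    ((hasFDerivAt_y hm 2 x).pow 2)
  have h2 := (hL.pow 2).unique
    (h1.congr_of_eventuallyEq (Filter.Eventually.of_forall fun z => R_sq hm z))
  refine hL.congr_fderiv (ContinuousLinearMap.ext fun X => ?_)
  have h3 := congrArg (fun l : E4 →L[ℝ] ℝ => l X) h2
  have hR := R_pos hm hx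
  simp at h3
  simp [Fin.sum_univ_four, gradR]
  field_simp
  linear_combination (1 / 2) * h3

theorem symR_R (hm : 0 < m) (hρ : 1 ≤ ρ) : SymR m ρ 1 n (R m) := by
  have key : ∃ C, ∀ x ∈ region m ρ, |R m x| ≤ C * R m x ^ (1 : ℤ) :=
    ⟨1, fun x _ => by simp [abs_of_nonneg (R_nonneg m x)]⟩
  induction n with
  | zero => exact key
  | succ n ih =>
    have hinv : SymR m ρ (-1) n fun x => (R m x)⁻¹ :=
      SymR.inv hρ one_pos (fun x _ => by simp) ih
    refine ⟨key, gradR m, fun x (hx : ρ < R m x) =>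
      hasFDerivAt_R_gradR hm (ne_zero_of_R_pos hm (by linarith)), fun a => ?_⟩
    fin_cases a
    · exact (symR_y hm hρ 0).mul hρ hinv (by norm_num)
    · exact (symR_y hm hρ 1).mul hρ hinv (by norm_num)
    · exact (symR_y hm hρ 2).mul hρ hinv (by norm_num)
    · exact Sym.zero

theorem symR_R_inv (hm : 0 < m) (hρ : 1 ≤ ρ) : SymR m ρ (-1) n fun x => (R m x)⁻¹ :=
  SymR.inv hρ one_pos (fun x _ => by simp) (symR_R hm hρ)

theorem symR_gradR (hm : 0 < m) (hρ : 1 ≤ ρ) (a : Fin 4) : SymR m ρ 0 n (gradR m a) := by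
  fin_cases a
  · exact (symR_y hm hρ 0).mul hρ (symR_R_inv hm hρ) (by norm_num)
  · exact (symR_y hm hρ 1).mul hρ (symR_R_inv hm hρ) (by norm_num)
  · exact (symR_y hm hρ 2).mul hρ (symR_R_inv hm hρ) (by norm_num)
  · exact Sym.zero

theorem symR_V (hm : 0 < m) (hρ : 1 ≤ ρ) : SymR m ρ 0 n (V m) := by
  have h : SymR m ρ 0 n fun x => 2 * m + (1 / 2) * (R m x)⁻¹ :=
    (SymR.const _).add (Sym.const_mul _ ((symR_R_inv hm hρ).mono hρ (by norm_num)))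
  refine Sym.congr (isOpen_region hm ρ) h fun x (hx : ρ < R m x) => ?_
  rw [V_eq hm (ne_zero_of_R_pos hm (by linarith)), mul_inv]
  ring

theorem two_mul_le_V (hm : 0 < m) {x : E4} (hx : x ≠ 0) : 2 * m ≤ V m x := by
  have := R_pos hm hx
  rw [V_eq hm hx, le_add_iff_nonneg_right]
  positivity

theorem symR_V_inv (hm : 0 < m) (hρ : 1 ≤ ρ) : SymR m ρ 0 n fun x => (V m x)⁻¹ := by
  have := SymR.inv (c := 2 * m) hρ (by positivity) (fun x (hx : ρ < R m x) => by
    simpa using two_mul_le_V hm (ne_zero_of_R_pos hm (by linarith))) (symR_V hm hρ (n := n))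
  simpa using this

theorem symR_diagCoeff (hm : 0 < m) (hρ : 1 ≤ ρ) (a : Fin 4) : SymR m ρ 0 n (diagCoeff m a) := by
  fin_cases a
  · exact symR_V hm hρ
  · exact symR_V hm hρ
  · exact symR_V hm hρ
  · exact symR_V_inv hm hρ

theorem symR_diagCoeff_inv (hm : 0 < m) (hρ : 1 ≤ ρ) (a : Fin 4) :
    SymR m ρ 0 n fun x => (diagCoeff m a x)⁻¹ := by
  fin_cases a
  · exact symR_V_inv hm hρ
  · exact symR_V_inv hm hρ
  · exact symR_V_inv hm hρ
  · simpa [diagCoeff] using symR_V hm hρ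

theorem symR_areaCoeff (hm : 0 < m) (hρ : 1 ≤ ρ) (a b : Fin 4) :
    SymR m ρ 1 n (areaCoeff m a b) := by
  have h0 := symR_y (n := n) hm hρ 0
  have h1 := symR_y (n := n) hm hρ 1
  have h2 := symR_y (n := n) hm hρ 2
  have hz : SymR m ρ 1 n 0 := Sym.zero
  fin_cases a <;> fin_cases b <;>
    first | exact hz | exact h0 | exact h1 | exact h2 | exact h0.neg | exact h1.neg | exact h2.neg

theorem symR_torsionCoeff (hm : 0 < m) (hρ : 1 ≤ ρ) (c a b : Fin 4) :
    SymR m ρ 0 n (torsionCoeff m c a b) := by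
  by_cases hc : c = 3
  · have hi := symR_R_inv (n := n) hm hρ
    have h : SymR m ρ 0 n fun x =>
        (-(1 / 2)) * ((R m x)⁻¹ * ((R m x)⁻¹ * ((R m x)⁻¹ * areaCoeff m a b x))) :=
      Sym.const_mul _ (hi.mul hρ (hi.mul hρ (hi.mul hρ (symR_areaCoeff hm hρ a b) le_rfl) le_rfl)
        (by norm_num))
    refine Sym.congr (isOpen_region hm ρ) h fun x (hx : ρ < R m x) => ?_
    have : R m x ≠ 0 := by linarith
    simp only [torsionCoeff, hc, if_true]
    field_simp
  · have : torsionCoeff m c a b = fun _ => 0 := by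
      ext x
      simp [torsionCoeff, hc]
    rw [this]
    exact Sym.zero

/-- The connection coefficients of the Taub-NUT metric in the coframe are bounded with all their
derivatives. -/
theorem exists_connection_symR (hm : 0 < m) (hρ : 1 ≤ ρ) (n : ℕ) :
    ∃ γ : Fin 4 → Fin 4 → Fin 4 → E4 → ℝ,
      (∀ x ∈ region m ρ, ∀ c i j, ∑ k, christoffel (taubNUT m) x k i j * coframe m c x (basisVec k)
        = pderiv i (fun z => coframe m c z (basisVec j)) x
          + ∑ a, ∑ b, γ c a b x * (coframe m a x (basisVec i) * coframe m b x (basisVec j))) ∧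
      ∀ c a b, SymR m ρ 0 n (γ c a b) := by
  choose d' h1 h2 using fun c => (symR_diagCoeff (n := n + 1) hm hρ c).2
  have hne : ∀ x ∈ region m ρ, x ≠ 0 := fun x (hx : ρ < R m x) =>
    ne_zero_of_R_pos hm (by linarith)
  refine ⟨fun c a b x => connCoeff (fun c => diagCoeff m c x) (fun c b => d' c b x)
    (fun c a b => torsionCoeff m c a b x) c a b, fun x hx c i j => ?_, fun c a b => ?_⟩
  · exact christoffel_contract (isOpen_region hm ρ)
      (fun x hx => taubNUT_apply hm (hne x hx))
      (fun x hx a => (diagCoeff_pos hm (hne x hx) a).ne')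
      (fun x hx => isUnit_det_coMatrix hm (hne x hx)) (fun x hx a => h1 a x hx)
      (fun x hx a i => differentiableAt_coframe hm (hne x hx) a _)
      (fun x hx => extDeriv_coframe hm (hne x hx)) hx c i j
  · have hif : ∀ (p : Prop) [Decidable p] (F : E4 → ℝ), SymR m ρ 0 n F →
        SymR m ρ 0 n fun x => if p then F x else 0 := by
      intro p _ F hF
      by_cases hp : p
      · simpa [hp] using hF
      · simpa [hp] using Sym.zero
    have hdt : ∀ c c' a b, SymR m ρ 0 n fun x => diagCoeff m c x * torsionCoeff m c' a b x :=
      fun c c' a b => (symR_diagCoeff hm hρ c).mul hρ (symR_torsionCoeff hm hρ c' a b) le_rfl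
    refine (symR_diagCoeff_inv hm hρ c).mul (l := 0) hρ (Sym.const_mul _ ?_) le_rfl
    exact (((((hif _ _ (h2 c a)).add (hif _ _ (h2 c b))).sub (hif _ _ (h2 a c))).sub
      (hdt c c a b)).add (hdt b b a c)).add (hdt a a b c)

/-- A tensor field whose components in the coframe are `O(Rᵏ)` with their first `ℓ` derivatives
has an `ℓ`-th covariant derivative of norm `O(Rᵏ)`. -/
theorem exists_norm_iterCovDeriv_le (hm : 0 < m) (hρ : 1 ≤ ρ) {r : ℕ} {T : TensorField r} (ℓ : ℕ)
    (hT : ∃ t, HasComps (coframe m) (region m ρ) T t ∧ ∀ A, SymR m ρ k ℓ (t A)) :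
    ∃ C, ∀ x ∈ region m ρ,
      tensorNorm (taubNUT m) (iterCovDeriv (taubNUT m) T ℓ) x ≤ C * R m x ^ k := by
  have hne : ∀ x ∈ region m ρ, x ≠ 0 := fun x (hx : ρ < R m x) =>
    ne_zero_of_R_pos hm (by linarith)
  have hiter : ∀ i j, i + j = ℓ → ∃ t, HasComps (coframe m) (region m ρ)
      (iterCovDeriv (taubNUT m) T i) t ∧ ∀ A, SymR m ρ k j (t A) := by
    intro i
    induction i with
    | zero =>
      intro j hj
      obtain rfl : j = ℓ := by omega
      exact hT
    | succ i ih =>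
      intro j hj
      obtain ⟨γ, h1, h2⟩ := exists_connection_symR (n := j) hm hρ
      exact exists_comps_covDeriv (isOpen_region hm ρ)
        (fun x hx a i => differentiableAt_coframe hm (hne x hx) a _) h1
        (fun c a b => symR_zero_iff.1 (h2 c a b)) (ih (j + 1) (by omega))
  choose M hM using fun a => (symR_diagCoeff_inv (n := 0) hm hρ a).bound
  refine exists_tensorNorm_le (d := diagCoeff m) (M := ∑ a, |M a|)
    (fun x hx => taubNUT_apply hm (hne x hx)) (fun x hx => diagCoeff_pos hm (hne x hx))
    (fun x hx => isUnit_det_coMatrix hm (hne x hx)) (fun x hx a => ?_) (hiter ℓ 0 rfl)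
  calc (diagCoeff m a x)⁻¹ ≤ |M a| :=
        (le_abs_self _).trans ((hM a x hx).trans (by simpa using le_abs_self _))
    _ ≤ ∑ a, |M a| := Finset.single_le_sum (f := fun a => |M a|) (fun a _ => abs_nonneg _)
        (Finset.mem_univ a)

end

/-! ### The map `ℶ` for large `R` -/

theorem P_mul_sq {m : ℝ} (hm : 0 < m) (x : E4) :
    P m x * (x 0 ^ 2 + x 1 ^ 2) = R m x + y m 0 x := by
  linarith [two_mul_y_zero hm x, two_mul_R hm x]

theorem Q_mul_sq {m : ℝ} (hm : 0 < m) (x : E4) :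
    Q m x * (x 2 ^ 2 + x 3 ^ 2) = R m x - y m 0 x := by
  linarith [two_mul_y_zero hm x, two_mul_R hm x]

theorem norm_sq_eq_R {m : ℝ} (hm : 0 < m) (x : E4) :
    ‖x‖ ^ 2 = Q m x * (R m x + y m 0 x) + P m x * (R m x - y m 0 x) := by
  rw [norm_sq_eq, ← P_mul_sq hm, ← Q_mul_sq hm]
  linear_combination (-(x 0 ^ 2 + x 1 ^ 2 + (x 2 ^ 2 + x 3 ^ 2))) * P_mul_Q m x

theorem weights_le_norm_sq {m : ℝ} (hm : 0 < m) (x : E4) :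
    Q m x * R m x ≤ ‖x‖ ^ 2 ∧ P m x * R m x ≤ ‖x‖ ^ 2 ∧ R m x ≤ ‖x‖ ^ 2 := by
  have hR := R_nonneg m x
  have hP := P_pos m x
  have hQ := Q_pos m x
  have hy := abs_le.1 (abs_y_le hm 0 x)
  have h1 : 0 ≤ Q m x * (R m x + y m 0 x) := mul_nonneg hQ.le (by linarith)
  have h2 : 0 ≤ P m x * (R m x - y m 0 x) := mul_nonneg hP.le (by linarith)
  rw [norm_sq_eq_R hm]
  rcases le_total 0 (y m 0 x) with h | h
  · have hQ1 : 1 ≤ Q m x := Real.one_le_exp (by positivity)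
    have hP1 : P m x ≤ 1 := Real.exp_le_one_iff.2 (by
      have : 0 ≤ 4 * m * y m 0 x := by positivity
      linarith)
    refine ⟨?_, ?_, ?_⟩ <;> nlinarith [mul_nonneg hQ.le h]
  · have hP1 : 1 ≤ P m x := Real.one_le_exp (by nlinarith)
    have hQ1 : Q m x ≤ 1 := Real.exp_le_one_iff.2 (by nlinarith)
    refine ⟨?_, ?_, ?_⟩ <;> nlinarith [mul_nonneg hP.le (neg_nonneg.2 h)]

/-- The factor `1 + a / (κ + r⁴)`. -/
def lam (a κ : ℝ) (x : E4) : ℝ := 1 + a / (κ + ‖x‖ ^ 4)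

/-- The function `λ² - 1`, where `λ = 1 + a / (κ + r⁴)`. -/
def mu (a κ : ℝ) (x : E4) : ℝ := lam a κ x ^ 2 - 1

/-- The variation `y₁ ∘ ℶ - y₁`. -/
def del (m a κ : ℝ) (x : E4) : ℝ := y m 0 (beth a κ x) - y m 0 x

section

variable {m a κ ρ : ℝ} {n : ℕ}

theorem beth_apply (a κ : ℝ) (x : E4) (i : Fin 4) : beth a κ x i = lam a κ x * x i := rfl

theorem symR_lam_sub_one (hm : 0 < m) (hκ : 0 < κ) (hρ : 1 ≤ ρ) :
    SymR m ρ (-2) n fun x => lam a κ x - 1 := by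
  have hP : Sym (coframe m) (region m ρ) (P m) n (P m) := by
    induction n with
    | zero => exact ⟨1, fun x _ => by rw [one_mul, abs_of_pos (P_pos m x)]⟩
    | succ n ih =>
      refine ⟨⟨1, fun x _ => by rw [one_mul, abs_of_pos (P_pos m x)]⟩,
        ![fun x => (-(4 * m)) * P m x, fun _ => 0, fun _ => 0, fun _ => 0], fun x _ => ?_, ?_⟩
      · refine (hasFDerivAt_P hm x).congr_fderiv ?_
        simp [Fin.sum_univ_four]
      · intro a
        fin_cases a
        · exact ih.const_mul _
        all_goals exact Sym.zero
  have hQ : Sym (coframe m) (region m ρ) (Q m) n (Q m) := by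
    induction n with
    | zero => exact ⟨1, fun x _ => by rw [one_mul, abs_of_pos (Q_pos m x)]⟩
    | succ n ih =>
      refine ⟨⟨1, fun x _ => by rw [one_mul, abs_of_pos (Q_pos m x)]⟩,
        ![fun x => (4 * m) * Q m x, fun _ => 0, fun _ => 0, fun _ => 0], fun x _ => ?_, ?_⟩
      · refine (hasFDerivAt_Q hm x).congr_fderiv ?_
        simp [Fin.sum_univ_four]
      · intro a
        fin_cases a
        · exact (ih hP.of_succ).const_mul _
        all_goals exact Sym.zero
  have hR := symR_R (n := n) hm hρ
  have hy := symR_y (n := n) hm hρ 0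
  have h2 : Sym (coframe m) (region m ρ) (fun x => ‖x‖ ^ 2) n fun x => ‖x‖ ^ 2 := by
    have e : (fun x : E4 => ‖x‖ ^ 2)
        = fun x => Q m x * (R m x + y m 0 x) + P m x * (R m x - y m 0 x) :=
      funext (norm_sq_eq_R hm)
    rw [show Sym (coframe m) (region m ρ) (fun x : E4 => ‖x‖ ^ 2) n (fun x : E4 => ‖x‖ ^ 2)
      ↔ Sym (coframe m) (region m ρ) (fun x : E4 => ‖x‖ ^ 2) n
        (fun x => Q m x * (R m x + y m 0 x) + P m x * (R m x - y m 0 x)) by rw [← e]]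
    refine Sym.add ((hQ.mul (hR.add hy)).weight_mono ?_ 1 ?_)
      ((hP.mul (hR.sub hy)).weight_mono ?_ 1 ?_)
    · intro x _
      have := R_nonneg m x
      have := Q_pos m x
      positivity
    · intro x _
      simpa using (weights_le_norm_sq hm x).1
    · intro x _
      have := R_nonneg m x
      have := P_pos m x
      positivity
    · intro x _
      simpa using (weights_le_norm_sq hm x).2.1
  have h4 : Sym (coframe m) (region m ρ) (fun x => κ + ‖x‖ ^ 4) n fun x => κ + ‖x‖ ^ 4 := by
    have e4 : (fun x : E4 => ‖x‖ ^ 4) = fun x => ‖x‖ ^ 2 * ‖x‖ ^ 2 := by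
      ext x
      ring
    have h4' : Sym (coframe m) (region m ρ) (fun x => ‖x‖ ^ 4) n fun x => ‖x‖ ^ 4 := by
      rw [e4]
      exact h2.mul h2
    refine Sym.add ((Sym.const κ).weight_mono (fun _ _ => zero_le_one) κ⁻¹ fun x _ => ?_)
      (h4'.weight_mono (fun x _ => by positivity) 1 fun x _ => by rw [one_mul]; linarith)
    rw [inv_mul_eq_div, le_div_iff₀ hκ]
    nlinarith [pow_nonneg (norm_nonneg x) 4]
  have h5 := Sym.inv one_pos (fun x _ => add_norm_pow_pos hκ x)
    (fun x _ => by rw [one_mul]; exact le_abs_self _) h4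
  have h6 : SymR m ρ (-2) n fun x => (κ + ‖x‖ ^ 4)⁻¹ := by
    refine h5.weight_mono (fun x _ => (inv_pos.2 (add_norm_pow_pos hκ x)).le) 1
      fun x (hx : ρ < R m x) => ?_
    have h7 := (weights_le_norm_sq hm x).2.2
    have hR0 : 0 < R m x := by linarith
    rw [one_mul, zpow_neg]
    refine inv_anti₀ (by positivity) ?_
    have : R m x ^ 2 ≤ (‖x‖ ^ 2) ^ 2 := by gcongr
    calc R m x ^ (2 : ℤ) = R m x ^ 2 := by norm_cast
      _ ≤ κ + ‖x‖ ^ 4 := by nlinarith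
  simp only [lam, add_sub_cancel_left, div_eq_mul_inv]
  exact h6.const_mul a

theorem symR_mu (hm : 0 < m) (hκ : 0 < κ) (hρ : 1 ≤ ρ) : SymR m ρ (-2) n (mu a κ) := by
  have h := symR_lam_sub_one (a := a) (n := n) hm hκ hρ
  have h2 : SymR m ρ (-2) n fun x => (lam a κ x - 1) * (lam a κ x - 1) + 2 * (lam a κ x - 1) :=
    (h.mul hρ h (by norm_num)).add (h.const_mul 2)
  have e : mu a κ = fun x => (lam a κ x - 1) * (lam a κ x - 1) + 2 * (lam a κ x - 1) := by
    ext x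
    rw [mu]
    ring
  rw [e]
  exact h2

theorem y_one_beth (x : E4) : y m 1 (beth a κ x) = (1 + mu a κ x) * y m 1 x := by
  simp only [y_one, beth_apply, mu]
  ring

theorem y_two_beth (x : E4) : y m 2 (beth a κ x) = (1 + mu a κ x) * y m 2 x := by
  simp only [y_two, beth_apply, mu]
  ring

theorem P_beth (x : E4) :
    P m (beth a κ x) = P m x * Real.exp (-(4 * m * del m a κ x)) := by
  rw [P, P, ← Real.exp_add, del]
  congr 1
  ring

theorem Q_beth (x : E4) : Q m (beth a κ x) = Q m x * Real.exp (4 * m * del m a κ x) := by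
  rw [Q, Q, ← Real.exp_add, del]
  congr 1
  ring

theorem del_eq (hm : 0 < m) (x : E4) : 2 * (y m 0 x + del m a κ x) = (1 + mu a κ x) *
    (Real.exp (-(4 * m * del m a κ x)) * (R m x + y m 0 x)
      - Real.exp (4 * m * del m a κ x) * (R m x - y m 0 x)) := by
  have h := two_mul_y_zero hm (beth a κ x)
  rw [P_beth, Q_beth] at h
  simp only [beth_apply] at h
  rw [← P_mul_sq hm, ← Q_mul_sq hm, mu]
  have e : y m 0 x + del m a κ x = y m 0 (beth a κ x) := by
    rw [del]
    ring
  rw [e, h]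
  ring

theorem R_beth (hm : 0 < m) (x : E4) : 2 * R m (beth a κ x) = (1 + mu a κ x) *
    (Real.exp (-(4 * m * del m a κ x)) * (R m x + y m 0 x)
      + Real.exp (4 * m * del m a κ x) * (R m x - y m 0 x)) := by
  rw [two_mul_R hm, P_beth, Q_beth, ← P_mul_sq hm, ← Q_mul_sq hm, mu]
  simp only [beth_apply]
  ring

theorem one_add_mu_nonneg (a κ : ℝ) (x : E4) : 0 ≤ 1 + mu a κ x := by
  rw [mu]
  nlinarith [sq_nonneg (lam a κ x)]

theorem abs_del_le (hm : 0 < m) (x : E4) : |del m a κ x| ≤ |mu a κ x| * R m x := by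
  have h := del_eq (a := a) (κ := κ) hm x
  have hμ := one_add_mu_nonneg a κ x
  have hy := abs_le.1 (abs_y_le hm 0 x)
  have hle : |mu a κ x * y m 0 x| ≤ |mu a κ x| * R m x := by
    rw [abs_mul]
    exact mul_le_mul_of_nonneg_left (abs_y_le hm 0 x) (abs_nonneg _)
  refine le_trans ?_ hle
  rcases le_total 0 (del m a κ x) with hd | hd
  · have hp : Real.exp (-(4 * m * del m a κ x)) ≤ 1 := Real.exp_le_one_iff.2 (by
      have : 0 ≤ 4 * m * del m a κ x := by positivity
      linarith)
    have hq : 1 ≤ Real.exp (4 * m * del m a κ x) := Real.one_le_exp (by positivity)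
    have h1 : Real.exp (-(4 * m * del m a κ x)) * (R m x + y m 0 x) ≤ R m x + y m 0 x :=
      mul_le_of_le_one_left (by linarith) hp
    have h2 : R m x - y m 0 x ≤ Real.exp (4 * m * del m a κ x) * (R m x - y m 0 x) :=
      le_mul_of_one_le_left (by linarith) hq
    have h3 := mul_le_mul_of_nonneg_left (show Real.exp (-(4 * m * del m a κ x)) *
      (R m x + y m 0 x) - Real.exp (4 * m * del m a κ x) * (R m x - y m 0 x) ≤ 2 * y m 0 x by
        linarith) hμ
    rw [abs_of_nonneg hd]
    exact le_trans (by linarith) (le_abs_self _)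
  · have hp : 1 ≤ Real.exp (-(4 * m * del m a κ x)) := Real.one_le_exp (by nlinarith)
    have hq : Real.exp (4 * m * del m a κ x) ≤ 1 := Real.exp_le_one_iff.2 (by nlinarith)
    have h1 : R m x + y m 0 x ≤ Real.exp (-(4 * m * del m a κ x)) * (R m x + y m 0 x) :=
      le_mul_of_one_le_left (by linarith) hp
    have h2 : Real.exp (4 * m * del m a κ x) * (R m x - y m 0 x) ≤ R m x - y m 0 x :=
      mul_le_of_le_one_left (by linarith) hq
    have h3 := mul_le_mul_of_nonneg_left (show 2 * y m 0 x ≤ Real.exp (-(4 * m * del m a κ x)) *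
      (R m x + y m 0 x) - Real.exp (4 * m * del m a κ x) * (R m x - y m 0 x) by
        linarith) hμ
    rw [abs_of_nonpos hd]
    exact le_trans (by linarith) (neg_le_abs _)

theorem abs_R_beth_sub_le (hm : 0 < m) (x : E4) :
    |R m (beth a κ x) - R m x| ≤ 2 * (|mu a κ x| * R m x) := by
  let s := Real.sqrt (y m 1 x ^ 2 + y m 2 x ^ 2)
  have hs : s ^ 2 = y m 1 x ^ 2 + y m 2 x ^ 2 := Real.sq_sqrt (by positivity)
  have hsR : s ≤ R m x := by
    refine Real.sqrt_le_iff.2 ⟨R_nonneg m x, ?_⟩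
    rw [R_sq hm]
    nlinarith [sq_nonneg (y m 0 x)]
  let u : ℂ := ⟨y m 0 x, s⟩
  let v : ℂ := ⟨y m 0 x + del m a κ x, (1 + mu a κ x) * s⟩
  have hu : ‖u‖ = R m x := by
    rw [← sq_eq_sq₀ (norm_nonneg _) (R_nonneg m x), R_sq hm, ← Complex.normSq_eq_norm_sq,
      Complex.normSq_apply]
    show y m 0 x * y m 0 x + s * s = _
    linarith
  have hv : ‖v‖ = R m (beth a κ x) := by
    rw [← sq_eq_sq₀ (norm_nonneg _) (R_nonneg m _), R_sq hm, ← Complex.normSq_eq_norm_sq,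
      Complex.normSq_apply, y_one_beth, y_two_beth]
    show (y m 0 x + del m a κ x) * (y m 0 x + del m a κ x)
      + (1 + mu a κ x) * s * ((1 + mu a κ x) * s) = _
    have e : y m 0 (beth a κ x) = y m 0 x + del m a κ x := by
      rw [del]
      ring
    rw [e]
    linear_combination (1 + mu a κ x) ^ 2 * hs
  rw [← hv]
  nth_rewrite 1 [← hu]
  refine (abs_norm_sub_norm_le v u).trans ((Complex.norm_le_abs_re_add_abs_im _).trans ?_)
  have e1 : (v - u).re = del m a κ x := by simp [u, v]
  have e2 : (v - u).im = mu a κ x * s := by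
    simp [u, v]
    ring
  rw [e1, e2, abs_mul, abs_of_nonneg (Real.sqrt_nonneg _ : 0 ≤ s)]
  have := abs_del_le (a := a) (κ := κ) hm x
  have := mul_le_mul_of_nonneg_left hsR (abs_nonneg (mu a κ x))
  linarith

theorem abs_mu_mul_R_le (hm : 0 < m) (hκ : 0 < κ) {x : E4} (hx : 1 + 12 * |a| < R m x) :
    |mu a κ x| * R m x ≤ 3 * |a| * (R m x)⁻¹ := by
  have ha := abs_nonneg a
  have hR : 0 < R m x := by linarith
  have h1 := (weights_le_norm_sq hm x).2.2
  have h2 : R m x ^ 2 ≤ κ + ‖x‖ ^ 4 := by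
    have : R m x ^ 2 ≤ (‖x‖ ^ 2) ^ 2 := by gcongr
    nlinarith
  have h3 : |lam a κ x - 1| ≤ |a| / R m x ^ 2 := by
    rw [lam, add_sub_cancel_left, abs_div, abs_of_pos (add_norm_pow_pos hκ x)]
    gcongr
  have h4 : |a| / R m x ^ 2 ≤ 1 := by
    rw [div_le_one (by positivity)]
    nlinarith
  have h5 : |lam a κ x + 1| ≤ 3 := by
    calc |lam a κ x + 1| = |(lam a κ x - 1) + 2| := by ring_nf
      _ ≤ |lam a κ x - 1| + |2| := abs_add_le _ _
      _ ≤ 3 := by norm_num; linarith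
  have h6 : |mu a κ x| ≤ 3 * (|a| / R m x ^ 2) := by
    rw [mu, show lam a κ x ^ 2 - 1 = (lam a κ x + 1) * (lam a κ x - 1) by ring, abs_mul]
    exact mul_le_mul h5 h3 (abs_nonneg _) (by norm_num)
  calc |mu a κ x| * R m x ≤ 3 * (|a| / R m x ^ 2) * R m x :=
        mul_le_mul_of_nonneg_right h6 hR.le
    _ = 3 * |a| * (R m x)⁻¹ := by field_simp

theorem half_R_le_R_beth (hm : 0 < m) (hκ : 0 < κ) {x : E4} (hx : 1 + 12 * |a| < R m x) :
    R m x / 2 ≤ R m (beth a κ x) := by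
  have ha := abs_nonneg a
  have hR : 0 < R m x := by linarith
  have h1 := (abs_R_beth_sub_le hm x).trans
    (mul_le_mul_of_nonneg_left (abs_mu_mul_R_le (a := a) hm hκ hx) zero_le_two)
  have h2 : 2 * (3 * |a| * (R m x)⁻¹) ≤ R m x / 2 := by
    rw [← div_eq_mul_inv, ← mul_div_assoc, div_le_iff₀ hR]
    nlinarith
  linarith [(abs_le.1 h1).1]

end

section

variable {m a κ ρ : ℝ} {n : ℕ}

theorem differentiableAt_beth (a : ℝ) (hκ : 0 < κ) (x : E4) : DifferentiableAt ℝ (beth a κ) x :=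
  (contDiff_beth a hκ).differentiable (by simp) x

/-- The components of the differential of `y₁ ∘ ℶ - y₁`, in terms of those of `λ² - 1`. -/
theorem hasFDerivAt_del (hm : 0 < m) (hκ : 0 < κ) {x : E4} (hx : x ≠ 0) {μ' : Fin 4 → ℝ}
    (hμ : HasFDerivAt (mu a κ) (∑ b, μ' b • coframe m b x) x) :
    HasFDerivAt (del m a κ) (∑ b, ((2 + 8 * m * R m (beth a κ x))⁻¹ *
      ((Real.exp (-(4 * m * del m a κ x)) * (R m x + y m 0 x)
          - Real.exp (4 * m * del m a κ x) * (R m x - y m 0 x)) * μ' b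
        + (1 + mu a κ x) * (Real.exp (-(4 * m * del m a κ x)) - Real.exp (4 * m * del m a κ x))
          * gradR m b x
        + ((1 + mu a κ x) * (Real.exp (-(4 * m * del m a κ x)) + Real.exp (4 * m * del m a κ x))
          - 2) * (if b = 0 then 1 else 0))) • coframe m b x) x := by
  have hd : DifferentiableAt ℝ (del m a κ) x :=
    (((contDiff_y_zero hm).comp (contDiff_beth a hκ)).sub (contDiff_y_zero hm)).differentiable
      (by simp) x
  have hL := hd.hasFDerivAt
  set L := fderiv ℝ (del m a κ) x
  have hy := hasFDerivAt_y_zero hm x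
  have hR := hasFDerivAt_R_gradR hm hx
  have h4 : HasFDerivAt (fun x => 4 * m * del m a κ x) ((4 * m) • L) x := hL.const_mul _
  have h1 := (hy.add hL).const_mul 2
  have h2 := (hμ.const_add 1).mul ((h4.neg.exp.mul (hR.add hy)).sub (h4.exp.mul (hR.sub hy)))
  have h3 := h1.unique
    (h2.congr_of_eventuallyEq (Filter.Eventually.of_forall fun z => del_eq hm z))
  refine hL.congr_fderiv (ContinuousLinearMap.ext fun X => ?_)
  have h5 := congrArg (fun l : E4 →L[ℝ] ℝ => l X) h3
  have hK : 0 < 2 + 8 * m * R m (beth a κ x) := by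
    have := R_nonneg m (beth a κ x)
    positivity
  have hRb := R_beth (a := a) (κ := κ) hm x
  have e0 : coframe m 0 x X = ∑ b, (if b = 0 then 1 else 0) * coframe m b x X := by simp
  have hsum : ∀ k z w v : ℝ, ∑ b, (k * (z * μ' b + w * gradR m b x
      + v * (if b = 0 then 1 else 0))) * coframe m b x X
      = k * (z * ∑ b, μ' b * coframe m b x X + w * ∑ b, gradR m b x * coframe m b x X
        + v * coframe m 0 x X) := by
    intro k z w v
    rw [e0]
    simp only [Finset.mul_sum, ← Finset.sum_add_distrib]
    exact Finset.sum_congr rfl fun b _ => by ring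
  simp only [sum_apply, smul_apply, smul_eq_mul, hsum]
  rw [eq_inv_mul_iff_mul_eq₀ hK.ne']
  simp at h5
  linear_combination h5 + 4 * m * L X * hRb

theorem symR_R_beth (hm : 0 < m) (hκ : 0 < κ) (hρ : 1 ≤ ρ) (hd : SymR m ρ (-1) n (del m a κ)) :
    SymR m ρ 0 n (fun x => Real.exp (-(4 * m * del m a κ x))) ∧
    SymR m ρ 0 n (fun x => Real.exp (4 * m * del m a κ x)) ∧
    SymR m ρ 1 n (fun x => R m (beth a κ x)) := by
  have h0 : SymR m ρ 0 n fun x => 4 * m * del m a κ x :=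
    Sym.const_mul _ (hd.mono hρ (by norm_num))
  have hp : SymR m ρ 0 n (fun x => Real.exp (-(4 * m * del m a κ x))) :=
    symR_zero_iff.2 (Sym.exp (symR_zero_iff.1 h0.neg))
  have hq : SymR m ρ 0 n (fun x => Real.exp (4 * m * del m a κ x)) :=
    symR_zero_iff.2 (Sym.exp (symR_zero_iff.1 h0))
  refine ⟨hp, hq, ?_⟩
  have hR := symR_R (n := n) hm hρ
  have hy := symR_y (n := n) hm hρ 0
  have hμ : SymR m ρ 0 n fun x => 1 + mu a κ x :=
    (SymR.const 1).add ((symR_mu hm hκ hρ).mono hρ (by norm_num))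
  have h : SymR m ρ 1 n fun x => (1 / 2) * ((1 + mu a κ x) *
      (Real.exp (-(4 * m * del m a κ x)) * (R m x + y m 0 x)
      + Real.exp (4 * m * del m a κ x) * (R m x - y m 0 x))) :=
    Sym.const_mul _ (hμ.mul (l := 1) hρ ((hp.mul (l := 1) hρ (hR.add hy) (by norm_num)).add
      (hq.mul (l := 1) hρ (hR.sub hy) (by norm_num))) (by norm_num))
  refine Sym.congr (isOpen_region hm ρ) h fun x _ => ?_
  rw [← R_beth hm]
  ring

theorem symR_del (hm : 0 < m) (hκ : 0 < κ) : SymR m (1 + 12 * |a|) (-1) n (del m a κ) := by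
  have hρ : 1 ≤ 1 + 12 * |a| := by linarith [abs_nonneg a]
  have key : ∃ C, ∀ x ∈ region m (1 + 12 * |a|), |del m a κ x| ≤ C * R m x ^ (-1 : ℤ) := by
    refine ⟨3 * |a|, fun x hx => ?_⟩
    rw [zpow_neg_one]
    exact (abs_del_le hm x).trans (abs_mu_mul_R_le hm hκ hx)
  induction n with
  | zero => exact key
  | succ n ih =>
    obtain ⟨-, μ', h1, h2⟩ := symR_mu (a := a) (n := n + 1) hm hκ hρ
    refine ⟨key, _, fun x (hx : 1 + 12 * |a| < R m x) => hasFDerivAt_del hm hκ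
      (ne_zero_of_R_pos hm (by linarith)) (h1 x hx), fun b => ?_⟩
    obtain ⟨hp, hq, hRb⟩ := symR_R_beth hm hκ hρ ih
    have hR := symR_R (n := n) hm hρ
    have hy := symR_y (n := n) hm hρ 0
    have hμ : SymR m (1 + 12 * |a|) 0 n fun x => 1 + mu a κ x :=
      (SymR.const 1).add ((symR_mu hm hκ hρ).mono hρ (by norm_num))
    have hK : SymR m (1 + 12 * |a|) (-1) n fun x => (2 + 8 * m * R m (beth a κ x))⁻¹ := by
      refine SymR.inv (c := 4 * m) hρ (by positivity) (fun x hx => ?_)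
        (((SymR.const 2).mono hρ (by norm_num)).add (hRb.const_mul _))
      have := half_R_le_R_beth hm hκ hx
      rw [zpow_one]
      nlinarith
    refine hK.mul (l := 0) hρ (Sym.add (Sym.add ?_ ?_) ?_) (by norm_num)
    · exact SymR.mul (k := 1) hρ ((hp.mul (l := 1) hρ (hR.add hy) (by norm_num)).sub
        (hq.mul (l := 1) hρ (hR.sub hy) (by norm_num))) (h2 b) (by norm_num)
    · exact (hμ.mul (l := 0) (j := 0) hρ (hp.sub hq) (by norm_num)).mul hρ (symR_gradR hm hρ b)
        (by norm_num)
    · exact SymR.mul (k := 0) hρ ((hμ.mul (l := 0) hρ (hp.add hq) (by norm_num)).sub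
        (SymR.const 2)) (SymR.const _) (by norm_num)

theorem symR_y_beth_sub (hm : 0 < m) (hκ : 0 < κ) (i : Fin 3) :
    SymR m (1 + 12 * |a|) (-1) n fun x => y m i (beth a κ x) - y m i x := by
  have hρ : 1 ≤ 1 + 12 * |a| := by linarith [abs_nonneg a]
  have hμ := symR_mu (a := a) (n := n) hm hκ hρ
  fin_cases i
  · exact symR_del hm hκ
  · have e : (fun x => y m 1 (beth a κ x) - y m 1 x) = fun x => mu a κ x * y m 1 x := by
      ext x
      rw [y_one_beth]
      ring
    show SymR m _ (-1) n fun x => y m 1 (beth a κ x) - y m 1 x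
    rw [e]
    exact hμ.mul hρ (symR_y hm hρ 1) (by norm_num)
  · have e : (fun x => y m 2 (beth a κ x) - y m 2 x) = fun x => mu a κ x * y m 2 x := by
      ext x
      rw [y_two_beth]
      ring
    show SymR m _ (-1) n fun x => y m 2 (beth a κ x) - y m 2 x
    rw [e]
    exact hμ.mul hρ (symR_y hm hρ 2) (by norm_num)

/-- The coefficient `τ` for which `ℶ^*η = η + τ (y₂ dy₃ - y₃ dy₂)`. -/
def twist (m a κ : ℝ) (x : E4) : ℝ :=
  (1 / 4) * ((1 + mu a κ x) * (Real.exp (-(4 * m * del m a κ x)) - Real.exp (4 * m * del m a κ x))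
    * ((R m x)⁻¹ * (R m (beth a κ x))⁻¹))

theorem fderiv_beth_apply (a : ℝ) (hκ : 0 < κ) (x X : E4) (i : Fin 4) :
    fderiv ℝ (beth a κ) x X i = lam a κ x * X i + fderiv ℝ (lam a κ) x X * x i := by
  have h : HasFDerivAt (lam a κ) (fderiv ℝ (lam a κ) x) x :=
    ((contDiff_beth_factor a hκ).differentiable (by simp) x).hasFDerivAt
  have h2 : HasFDerivAt (beth a κ) _ x := h.smul (hasFDerivAt_id x)
  rw [h2.fderiv]
  simp

theorem coframe_three_beth (hm : 0 < m) (hκ : 0 < κ) {x : E4} (hx : x ≠ 0)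
    (hb : 0 < R m (beth a κ x)) (X : E4) :
    coframe m 3 (beth a κ x) (fderiv ℝ (beth a κ) x X) = coframe m 3 x X
      + twist m a κ x * (y m 1 x * coframe m 2 x X - y m 2 x * coframe m 1 x X) := by
  have hR := R_pos hm hx
  have h1 := two_mul_R hm x
  have h2 := R_beth (a := a) (κ := κ) hm x
  rw [← P_mul_sq hm, ← Q_mul_sq hm] at h2
  have h3 := P_mul_Q m x
  rw [coframe_three_apply, coframe_three_apply, coframe_one_apply, coframe_two_apply, y_one, y_two,
    P_beth, Q_beth, twist]
  simp only [fderiv_beth_apply a hκ, beth_apply]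
  have hμ : 1 + mu a κ x = lam a κ x ^ 2 := by
    rw [mu]
    ring
  rw [hμ] at h2 ⊢
  generalize Real.exp (-(4 * m * del m a κ x)) = p at *
  generalize Real.exp (4 * m * del m a κ x) = q at *
  generalize fderiv ℝ (lam a κ) x X = l at *
  generalize lam a κ x = lam at *
  generalize R m (beth a κ x) = r at *
  generalize R m x = s at *
  generalize P m x = P at *
  generalize Q m x = Q at *
  field_simp
  linear_combination
    2 * lam ^ 2 * (P * p * (x 0 * X 1 - x 1 * X 0) - Q * q * (x 2 * X 3 - x 3 * X 2)) * h1
    - 2 * (P * (x 0 * X 1 - x 1 * X 0) - Q * (x 2 * X 3 - x 3 * X 2)) * h2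
    + 2 * lam ^ 2 * (p - q) * ((x 2 ^ 2 + x 3 ^ 2) * (x 0 * X 1 - x 1 * X 0)
      + (x 0 ^ 2 + x 1 ^ 2) * (x 2 * X 3 - x 3 * X 2)) * h3

/-- The pull-back of the coframe by `ℶ`. -/
theorem exists_coframe_beth (hm : 0 < m) (hκ : 0 < κ) (n : ℕ) :
    ∃ M : Fin 4 → Fin 4 → E4 → ℝ, (∀ c b, SymR m (1 + 12 * |a|) (-1) n (M c b)) ∧
      ∀ x ∈ region m (1 + 12 * |a|), ∀ c X,
        coframe m c (beth a κ x) (fderiv ℝ (beth a κ) x X)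
          = coframe m c x X + ∑ b, M c b x * coframe m b x X := by
  have hρ : 1 ≤ 1 + 12 * |a| := by linarith [abs_nonneg a]
  choose F h1 h2 using fun i => (symR_y_beth_sub (a := a) (κ := κ) (n := n + 1) hm hκ i).2
  obtain ⟨hp, hq, hRb⟩ := symR_R_beth hm hκ hρ (symR_del (a := a) (n := n) hm hκ)
  have hμ : SymR m (1 + 12 * |a|) 0 n fun x => 1 + mu a κ x :=
    (SymR.const 1).add ((symR_mu hm hκ hρ).mono hρ (by norm_num))
  have hRi : SymR m (1 + 12 * |a|) (-1) n fun x => (R m (beth a κ x))⁻¹ :=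
    SymR.inv (c := 1 / 2) hρ (by norm_num) (fun x hx => by
      have := half_R_le_R_beth hm hκ hx
      rw [zpow_one]
      linarith) hRb
  have hτ : SymR m (1 + 12 * |a|) (-2) n (twist m a κ) :=
    Sym.const_mul _ ((hμ.mul (l := 0) hρ (hp.sub hq) le_rfl).mul hρ
      ((symR_R_inv hm hρ).mul hρ hRi le_rfl) (by norm_num))
  refine ⟨Fin.lastCases ![fun _ => 0, fun x => -(twist m a κ x * y m 2 x),
    fun x => twist m a κ x * y m 1 x, fun _ => 0] F, fun c b => ?_, fun x hx c X => ?_⟩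
  · induction c using Fin.lastCases with
    | last =>
      simp only [Fin.lastCases_last]
      fin_cases b
      · exact Sym.zero
      · exact (hτ.mul (j := -1) hρ (symR_y hm hρ 2) (by norm_num)).neg
      · exact hτ.mul hρ (symR_y hm hρ 1) (by norm_num)
      · exact Sym.zero
    | cast i =>
      simp only [Fin.lastCases_castSucc]
      exact h2 i b
  · have hxR : 1 + 12 * |a| < R m x := hx
    have hx0 := ne_zero_of_R_pos hm (show 0 < R m x by linarith)
    induction c using Fin.lastCases with
    | last =>
      have hb := half_R_le_R_beth (κ := κ) hm hκ hxR
      simp only [Fin.lastCases_last]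
      rw [show Fin.last 3 = 3 from rfl,
        coframe_three_beth hm hκ hx0 (by linarith)]
      simp [Fin.sum_univ_four]
      ring
    | cast i =>
      simp only [Fin.lastCases_castSucc]
      have h3 := (hasFDerivAt_y hm i (beth a κ x)).comp x
        (differentiableAt_beth a hκ x).hasFDerivAt
      have h4 := (h3.sub (hasFDerivAt_y hm i x)).unique (h1 i x hx)
      have h5 := congrArg (fun l : E4 →L[ℝ] ℝ => l X) h4
      simp at h5
      linarith

theorem symR_diagCoeff_beth (hm : 0 < m) (hκ : 0 < κ) (c : Fin 4) :
    SymR m (1 + 12 * |a|) 0 n (fun x => diagCoeff m c (beth a κ x)) ∧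
    SymR m (1 + 12 * |a|) (-1) n (fun x => diagCoeff m c (beth a κ x) - diagCoeff m c x) := by
  have hρ : 1 ≤ 1 + 12 * |a| := by linarith [abs_nonneg a]
  have hpos : ∀ x ∈ region m (1 + 12 * |a|), x ≠ 0 ∧ beth a κ x ≠ 0 :=
    fun x (hx : 1 + 12 * |a| < R m x) => ⟨ne_zero_of_R_pos hm (by linarith),
      ne_zero_of_R_pos hm (by linarith [half_R_le_R_beth (κ := κ) hm hκ hx])⟩
  obtain ⟨-, -, hRb⟩ := symR_R_beth hm hκ hρ (symR_del (a := a) (n := n) hm hκ)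
  have hRi : SymR m (1 + 12 * |a|) (-1) n fun x => (R m (beth a κ x))⁻¹ :=
    SymR.inv (c := 1 / 2) hρ (by norm_num) (fun x hx => by
      have := half_R_le_R_beth hm hκ hx
      rw [zpow_one]
      linarith) hRb
  have hsub : SymR m (1 + 12 * |a|) (-1) n fun x => V m (beth a κ x) - V m x := by
    have h : SymR m (1 + 12 * |a|) (-1) n
        fun x => (1 / 2) * ((R m (beth a κ x))⁻¹ - (R m x)⁻¹) :=
      Sym.const_mul _ (hRi.sub (symR_R_inv hm hρ))
    refine Sym.congr (isOpen_region hm _) h fun x hx => ?_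
    rw [V_eq hm (hpos x hx).1, V_eq hm (hpos x hx).2, mul_inv, mul_inv]
    ring
  have hV : SymR m (1 + 12 * |a|) 0 n fun x => V m (beth a κ x) := by
    refine Sym.congr (isOpen_region hm _)
      ((hsub.mono hρ (show -1 ≤ 0 by norm_num)).add (symR_V hm hρ)) fun x _ => ?_
    ring
  have hVi : SymR m (1 + 12 * |a|) 0 n fun x => (V m (beth a κ x))⁻¹ := by
    have := SymR.inv (c := 2 * m) hρ (by positivity) (fun x hx => by
      simpa using two_mul_le_V hm (hpos x hx).2) hV
    simpa using this
  have hisub : SymR m (1 + 12 * |a|) (-1) n fun x => (V m (beth a κ x))⁻¹ - (V m x)⁻¹ := by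
    have h : SymR m (1 + 12 * |a|) (-1) n
        fun x => -((V m (beth a κ x) - V m x) * ((V m (beth a κ x))⁻¹ * (V m x)⁻¹)) :=
      (hsub.mul (j := -1) hρ (hVi.mul (j := 0) hρ (symR_V_inv hm hρ) le_rfl) (by norm_num)).neg
    refine Sym.congr (isOpen_region hm _) h fun x hx => ?_
    have := V_pos hm (hpos x hx).1
    have := V_pos hm (hpos x hx).2
    field_simp
    ring
  fin_cases c
  · exact ⟨hV, hsub⟩
  · exact ⟨hV, hsub⟩
  · exact ⟨hV, hsub⟩
  · exact ⟨hVi, hisub⟩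

theorem coframe_sum_basisVec (θ : E4 →L[ℝ] ℝ) (X : E4) : θ X = ∑ i, θ (basisVec i) * X i := by
  have hX : X = ∑ i, X i • basisVec i := by
    ext j
    simp [basisVec, Fin.sum_univ_four]
    fin_cases j <;> simp
  conv_lhs => rw [hX, map_sum]
  simp only [map_smul, smul_eq_mul, mul_comm]

theorem pullback_beth_apply (hm : 0 < m) {x : E4} (hb : beth a κ x ≠ 0) (i j : Fin 4) :
    pullback (beth a κ) (taubNUT m) x i j = ∑ c, diagCoeff m c (beth a κ x) *
      (coframe m c (beth a κ x) (fderiv ℝ (beth a κ) x (basisVec i))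
        * coframe m c (beth a κ x) (fderiv ℝ (beth a κ) x (basisVec j))) := by
  simp only [pullback, Matrix.of_apply, taubNUT_apply hm hb]
  simp only [coframe_sum_basisVec _ (fderiv ℝ (beth a κ) x (basisVec _)), Finset.sum_mul_sum]
  simp only [Finset.mul_sum, Finset.sum_mul]
  conv_lhs => enter [2, k]; rw [Finset.sum_comm]
  rw [Finset.sum_comm]
  refine Finset.sum_congr rfl fun c _ => Finset.sum_congr rfl fun k _ =>
    Finset.sum_congr rfl fun l _ => by ring

/-- The components of `ℶ^* f - f` in the coframe are `O(R⁻¹)` with all their derivatives. -/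
theorem exists_comps_pullback_sub (hm : 0 < m) (hκ : 0 < κ) (n : ℕ) :
    ∃ t, HasComps (coframe m) (region m (1 + 12 * |a|))
      (BilinField.toTensor (pullback (beth a κ) (taubNUT m) - taubNUT m)) t ∧
      ∀ A, SymR m (1 + 12 * |a|) (-1) n (t A) := by
  have hρ : 1 ≤ 1 + 12 * |a| := by linarith [abs_nonneg a]
  obtain ⟨M, h1, h2⟩ := exists_coframe_beth (a := a) hm hκ n
  let δ : Fin 4 → Fin 4 → ℝ := fun c b => if c = b then 1 else 0
  refine ⟨fun A x => ∑ c, ((diagCoeff m c (beth a κ x) - diagCoeff m c x) * (δ c (A 0) * δ c (A 1))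
    + diagCoeff m c (beth a κ x) * (δ c (A 0) * M c (A 1) x + δ c (A 1) * M c (A 0) x
      + M c (A 0) x * M c (A 1) x)), fun x hx I => ?_, fun A => ?_⟩
  · have hxR : 1 + 12 * |a| < R m x := hx
    have hx0 : x ≠ 0 := ne_zero_of_R_pos hm (by linarith [abs_nonneg a])
    have hb : beth a κ x ≠ 0 := ne_zero_of_R_pos hm
      (by linarith [half_R_le_R_beth (κ := κ) hm hκ hxR, abs_nonneg a])
    rw [← (finTwoArrowEquiv (Fin 4)).symm.sum_comp, Fintype.sum_prod_type]
    simp only [Fin.prod_univ_two, finTwoArrowEquiv_symm_apply, Matrix.cons_val_zero,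
      Matrix.cons_val_one]
    show pullback (beth a κ) (taubNUT m) x (I 0) (I 1) - taubNUT m x (I 0) (I 1) = _
    rw [pullback_beth_apply hm hb, taubNUT_apply hm hx0, ← Finset.sum_sub_distrib]
    simp only [h2 x hx, Finset.sum_mul]
    conv_rhs => enter [2, b]; rw [Finset.sum_comm]
    rw [Finset.sum_comm]
    refine Finset.sum_congr rfl fun c _ => ?_
    have hδ : ∀ X, coframe m c x X = ∑ b, δ c b * coframe m b x X := by
      intro X
      simp [δ]
    set u := ∑ b, M c b x * coframe m b x (basisVec (I 0)) with hu
    set v := ∑ b, M c b x * coframe m b x (basisVec (I 1)) with hv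
    calc _ = (diagCoeff m c (beth a κ x) - diagCoeff m c x) *
          (coframe m c x (basisVec (I 0)) * coframe m c x (basisVec (I 1)))
          + diagCoeff m c (beth a κ x) * (coframe m c x (basisVec (I 0)) * v
            + u * coframe m c x (basisVec (I 1)) + u * v) := by ring
      _ = _ := by
          rw [hδ (basisVec (I 0)), hδ (basisVec (I 1)), hu, hv]
          simp only [Finset.sum_mul_sum]
          simp only [← Finset.sum_add_distrib, Finset.mul_sum]
          refine Finset.sum_congr rfl fun b _ => Finset.sum_congr rfl fun b' _ => by ring
  · refine Sym.sum _ fun c _ => ?_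
    obtain ⟨k1, k2⟩ := symR_diagCoeff_beth (a := a) (n := n) hm hκ c
    refine Sym.add (k2.mul hρ (SymR.const _) (by norm_num)) (k1.mul (l := -1) hρ ?_ (by norm_num))
    exact Sym.add (Sym.add (Sym.const_mul _ (h1 c _)) (Sym.const_mul _ (h1 c _)))
      ((h1 c _).mul hρ (h1 c _) (by norm_num))

end

end TaubNUT

end

open TaubNUT in
theorem lemma1p11 (m a κ : ℝ) (hm : 0 < m) (hκ : 0 < κ) :
    (∀ ℓ : ℕ, ℓ ≤ 2 → ∃ C : ℝ, ∀ x : TaubNUT.E4, x ≠ 0 →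
      TaubNUT.tensorNorm (TaubNUT.taubNUT m)
        (TaubNUT.iterCovDeriv (TaubNUT.taubNUT m)
          (TaubNUT.BilinField.toTensor
            (TaubNUT.pullback (TaubNUT.beth a κ) (TaubNUT.taubNUT m) - TaubNUT.taubNUT m)) ℓ) x
        ≤ C * (TaubNUT.R m x)⁻¹) ∧
    (∃ C : ℝ, ∀ x : TaubNUT.E4, x ≠ 0 →
      |TaubNUT.R m (TaubNUT.beth a κ x) - TaubNUT.R m x| ≤ C * (TaubNUT.R m x)⁻¹) := by
  have hρ : 1 ≤ 1 + 12 * |a| := by linarith [abs_nonneg a]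
  refine ⟨fun ℓ _ => ?_, ?_⟩
  · have hsm : ∀ I, ContDiff ℝ (⊤ : ℕ∞) fun x =>
        BilinField.toTensor (pullback (beth a κ) (taubNUT m) - taubNUT m) x I := fun I =>
      (contDiff_pullback (contDiff_beth a hκ) (contDiff_taubNUT hm) _ _).sub
        (contDiff_taubNUT hm _ _)
    refine exists_bound_of_continuous hm (continuous_tensorNorm (contDiff_taubNUT hm)
      (det_taubNUT_ne_zero hm) (contDiff_iterCovDeriv (contDiff_taubNUT hm)
      (det_taubNUT_ne_zero hm) hsm ℓ)) (ρ := 1 + 12 * |a|) ?_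
    obtain ⟨C, hC⟩ := exists_norm_iterCovDeriv_le hm hρ ℓ (exists_comps_pullback_sub hm hκ ℓ)
    exact ⟨C, fun x hx => by simpa using hC x hx⟩
  · have hR := (contDiff_R hm).continuous
    refine exists_bound_of_continuous hm
      ((hR.comp (contDiff_beth a hκ).continuous).sub hR).abs (ρ := 1 + 12 * |a|) ?_
    refine ⟨2 * (3 * |a|), fun x hx => (abs_R_beth_sub_le hm x).trans ?_⟩
    rw [mul_assoc]
    exact mul_le_mul_of_nonneg_left (abs_mu_mul_R_le hm hκ hx) zero_le_two
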